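/- **Setting.** Let $\mathbb F\in\{\mathbb R,\mathbb C,\mathbb H,\mathbb O\}$, $n\in\{1,2,\dots\}$ with $n=1$ if $\mathbb F=\mathbb O$, $k:=\dim_{\mathbb R}\mathbb F-1$, $d:=(k+1)n+k$ and $t\in\{0,1,2,\dots\}$. Let $S^k\subset\mathbb F$ and $S^d\subset\mathbb F^{n+1}$ be the Euclidean unit spheres with their standard surface measures, and for $\omega\in\mathbb F^{n+1}$, $z\in\mathbb F$ put $\omega z:=(\omega_1z,\dots,\omega_{n+1}z)$. For $\omega\in S^d$ let $$[\omega]:=\begin{cases}\{(\omega\overline{\omega}_{n+1})z/|\omega_{n+1}| : z\in S^k\} & \omega_{n+1}\ne0,\\ \{\omega z: z\in S^k\} & \omega_{n+1}=0,\end{cases}$$ let $\mathbb{FP}^n:=\{[\omega]:\omega\in S^d\}$ with its standard measure, normalized to be the pushforward of the surface measure of $S^d$ under the $\mathbb F$-projective map $\Pi_{\mathbb F}:S^d\to\mathbb{FP}^n$, $\omega\mapsto[\omega]$. For $n=1$ the $\mathbb F$-Hopf map is $\pi_{\mathbb F}:S^{2k+1}\subset\mathbb F^2\to S^{k+1}\subset\mathbb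 R\times\mathbb F$, $(\omega_1,\omega_2)\mapsto(|\omega_1|^2-|\omega_2|^2,\,2\omega_1\overline{\omega}_2)$. For a unit sphere $S$ of a Euclidean space, $P_s(S)$ is the set of restrictions to $S$ of real polynomials of degree at most $s$, and $P_s(\mathbb{FP}^n)$ is the set of $f:\mathbb{FP}^n\to\mathbb R$ with $f\circ\Pi_{\mathbb F}\in P_{2s+1}(S^d)$. A weighted $s$-design on $\Sigma$ (a sphere or $\mathbb{FP}^n$, with measure $\rho$) is a pair of a finite set $X\subset\Sigma$ and a function $\lambda:X\to\mathbb R_{>0}$ with $\sum_{x\in X}\lambda(x)f(x)=\frac1{\rho(\Sigma)}\int_\Sigma f\,d\rho$ for all $f\in P_s(\Sigma)$. **Theorem.** Let $\Pi:S^d\to\Sigma$ be either $\Pi_{\mathbb F}:S^d\to\mathbb{FP}^n$ or, with $n=1$, $\pi_{\mathbb F}:S^{2k+1}\to S^{k+1}$. Let $Y\subset\Sigma$ be finite, $\lambda_Y:Y\to\mathbb R_{>0}$, and for each $y\in Y$ let $Z_y\subset S^k$ be finite, $\lambda_y:Z_y\to\mathbb R_{>0}$ and $z_y\in\Pi^{-1}(y)$;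 if $\mathbb F=\mathbb O$, assume moreover that $z_yz\in\Pi^{-1}(y)$ for all $y\in Y$ and $z\in S^k$ (for $\mathbb F\neq\mathbb O$ this holds for every $z_y\in\Pi^{-1}(y)$). Put $$X:=\bigcup_{y\in Y}\{z_yz: z\in Z_y\},\qquad \lambda(z_yz):=\lambda_Y(y)\lambda_y(z)\quad(y\in Y,\ z\in Z_y).$$ Then the union is disjoint and $\lambda:X\to\mathbb R_{>0}$ is well defined, and: 1. If $(Z_y,\lambda_y)$ is a weighted $t$-design on $S^k$ for each $y\in Y$, then $(X,\lambda)$ is a weighted $t$-design on $S^d$ if and only if $(Y,\lambda_Y)$ is a weighted $\lfloor t/2\rfloor$-design on $\Sigma$. 2. If $\sum_{z\in Z_y}\lambda(z_yz)=\lambda_Y(y)$ for each $y\in Y$ and $(X,\lambda)$ is a weighted $t$-design on $S^d$, then $(Y,\lambda_Y)$ is a weighted $\lfloor t/2\rfloor$-design on $\Sigma$. -/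

import Mathlib

open MeasureTheory Metric
open scoped Quaternion

noncomputable section

/-! ### The octonions, by Cayley–Dickson doubling of the quaternions -/

/-- The octonions: pairs of quaternions, with the Euclidean norm of `ℝ⁸`. -/
def Octonion : Type := WithLp 2 (ℍ[ℝ] × ℍ[ℝ])

namespace Octonion

instance : NormedAddCommGroup Octonion :=
  inferInstanceAs (NormedAddCommGroup (WithLp 2 (ℍ[ℝ] × ℍ[ℝ])))

instance : InnerProductSpace ℝ Octonion :=
  inferInstanceAs (InnerProductSpace ℝ (WithLp 2 (ℍ[ℝ] × ℍ[ℝ])))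

instance : FiniteDimensional ℝ Octonion :=
  inferInstanceAs (FiniteDimensional ℝ (WithLp 2 (ℍ[ℝ] × ℍ[ℝ])))

/-- The octonion `(a, b)`. -/
def mk (a b : ℍ[ℝ]) : Octonion := WithLp.toLp 2 (a, b)

/-- First quaternionic component. -/
def fst (x : Octonion) : ℍ[ℝ] := (WithLp.ofLp x).1

/-- Second quaternionic component. -/
def snd (x : Octonion) : ℍ[ℝ] := (WithLp.ofLp x).2

/-- The product `(a, b)(c, d) = (ac - d b̄, ā d + c b)`. -/
instance : Mul Octonion :=
  ⟨fun x y => mk (x.fst * y.fst - y.snd * star x.snd) (star x.fst * y.snd + y.fst * x.snd)⟩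

/-- The conjugate of `(a, b)` is `(ā, -b)`. -/
instance : Star Octonion := ⟨fun x => mk (star x.fst) (-x.snd)⟩

theorem norm_sq_eq (x : Octonion) : ‖x‖ ^ 2 = ‖x.fst‖ ^ 2 + ‖x.snd‖ ^ 2 :=
  WithLp.prod_norm_sq_eq_of_L2 (α := ℍ[ℝ]) (β := ℍ[ℝ]) x

theorem fst_mul (x y : Octonion) :
    (x * y).fst = x.fst * y.fst - y.snd * star x.snd := rfl

theorem snd_mul (x y : Octonion) :
    (x * y).snd = star x.fst * y.snd + y.fst * x.snd := rfl

theorem norm_mul (x y : Octonion) : ‖x * y‖ = ‖x‖ * ‖y‖ := by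
  have h : ‖x * y‖ ^ 2 = (‖x‖ * ‖y‖) ^ 2 := by
    rw [mul_pow, norm_sq_eq, norm_sq_eq, norm_sq_eq, fst_mul, snd_mul]
    simp only [← Quaternion.normSq_eq_norm_mul_self, pow_two, Quaternion.normSq_def']
    simp only [Quaternion.re_sub, Quaternion.imI_sub, Quaternion.imJ_sub, Quaternion.imK_sub,
      Quaternion.re_add, Quaternion.imI_add, Quaternion.imJ_add, Quaternion.imK_add,
      Quaternion.re_mul, Quaternion.imI_mul, Quaternion.imJ_mul, Quaternion.imK_mul,
      Quaternion.re_star, Quaternion.imI_star, Quaternion.imJ_star, Quaternion.imK_star]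
    ring
  exact (sq_eq_sq₀ (norm_nonneg _) (by positivity)).1 h

theorem norm_star (x : Octonion) : ‖star x‖ = ‖x‖ := by
  have h : ‖star x‖ ^ 2 = ‖x‖ ^ 2 := by
    rw [norm_sq_eq, norm_sq_eq]
    change ‖star x.fst‖ ^ 2 + ‖-x.snd‖ ^ 2 = _
    rw [norm_neg, _root_.norm_star]
  exact (sq_eq_sq₀ (norm_nonneg _) (norm_nonneg _)).1 h

end Octonion

/-! ### The four real normed division algebras -/

/-- Labels for `ℝ`, `ℂ`, `ℍ`, `𝕆`. -/
inductive DivAlg : Type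
  | real
  | complex
  | quaternion
  | octonion

namespace DivAlg

/-- The algebra `𝔽 ∈ {ℝ, ℂ, ℍ, 𝕆}`, of real dimension `k + 1` with `k = 0, 1, 3, 7`. -/
def Carrier : DivAlg → Type
  | real => ℝ
  | complex => ℂ
  | quaternion => ℍ[ℝ]
  | octonion => Octonion

variable (𝔽 : DivAlg)

instance : NormedAddCommGroup 𝔽.Carrier :=
  match 𝔽 with
  | real => inferInstanceAs (NormedAddCommGroup ℝ)
  | complex => inferInstanceAs (NormedAddCommGroup ℂ)
  | quaternion => inferInstanceAs (NormedAddCommGroup ℍ[ℝ])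
  | octonion => inferInstanceAs (NormedAddCommGroup Octonion)

instance : InnerProductSpace ℝ 𝔽.Carrier :=
  match 𝔽 with
  | real => inferInstanceAs (InnerProductSpace ℝ ℝ)
  | complex => inferInstanceAs (InnerProductSpace ℝ ℂ)
  | quaternion => inferInstanceAs (InnerProductSpace ℝ ℍ[ℝ])
  | octonion => inferInstanceAs (InnerProductSpace ℝ Octonion)

instance : Mul 𝔽.Carrier :=
  match 𝔽 with
  | real => inferInstanceAs (Mul ℝ)
  | complex => inferInstanceAs (Mul ℂ)
  | quaternion => inferInstanceAs (Mul ℍ[ℝ])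
  | octonion => inferInstanceAs (Mul Octonion)

/-- Conjugation. -/
instance : Star 𝔽.Carrier :=
  match 𝔽 with
  | real => inferInstanceAs (Star ℝ)
  | complex => inferInstanceAs (Star ℂ)
  | quaternion => inferInstanceAs (Star ℍ[ℝ])
  | octonion => inferInstanceAs (Star Octonion)

instance : FiniteDimensional ℝ 𝔽.Carrier :=
  match 𝔽 with
  | real => inferInstanceAs (FiniteDimensional ℝ ℝ)
  | complex => inferInstanceAs (FiniteDimensional ℝ ℂ)
  | quaternion => inferInstanceAs (FiniteDimensional ℝ ℍ[ℝ])
  | octonion => inferInstanceAs (FiniteDimensional ℝ Octonion)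

instance : MeasurableSpace 𝔽.Carrier := borel _

instance : BorelSpace 𝔽.Carrier := ⟨rfl⟩

instance : SecondCountableTopology 𝔽.Carrier :=
  haveI : ProperSpace 𝔽.Carrier := FiniteDimensional.proper ℝ _
  inferInstance

theorem norm_mul (a b : 𝔽.Carrier) : ‖a * b‖ = ‖a‖ * ‖b‖ :=
  match 𝔽, a, b with
  | real, a, b => _root_.norm_mul (α := ℝ) a b
  | complex, a, b => _root_.norm_mul (α := ℂ) a b
  | quaternion, a, b => _root_.norm_mul (α := ℍ[ℝ]) a b
  | octonion, a, b => Octonion.norm_mul a b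

theorem norm_star (a : 𝔽.Carrier) : ‖star a‖ = ‖a‖ :=
  match 𝔽, a with
  | real, a => _root_.norm_star (E := ℝ) a
  | complex, a => _root_.norm_star (E := ℂ) a
  | quaternion, a => _root_.norm_star (E := ℍ[ℝ]) a
  | octonion, a => Octonion.norm_star a

/-- `𝔽^{n+1}` with its Euclidean norm, a real inner product space of dimension `d + 1`. -/
abbrev Vec (n : ℕ) : Type := PiLp 2 (fun _ : Fin (n + 1) => 𝔽.Carrier)

/-- The unit sphere `S^d ⊂ 𝔽^{n+1}`, `d = (k + 1) n + k`. -/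
abbrev Sph (n : ℕ) : Type := sphere (0 : 𝔽.Vec n) 1

/-- The unit sphere `S^k ⊂ 𝔽`. -/
abbrev UnitSph : Type := sphere (0 : 𝔽.Carrier) 1

/-- The space `ℝ × 𝔽` with its Euclidean norm. -/
abbrev HopfVec : Type := WithLp 2 (ℝ × 𝔽.Carrier)

/-- The unit sphere `S^{k+1} ⊂ ℝ × 𝔽`. -/
abbrev HopfSph : Type := sphere (0 : 𝔽.HopfVec) 1

variable {𝔽}

/-- Coordinatewise right multiplication `(ω₁, …, ω_{n+1}) a = (ω₁ a, …, ω_{n+1} a)`. -/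
def rmul {n : ℕ} (ω : 𝔽.Vec n) (a : 𝔽.Carrier) : 𝔽.Vec n :=
  WithLp.toLp 2 (fun i => ω i * a)

theorem norm_rmul {n : ℕ} (ω : 𝔽.Vec n) (a : 𝔽.Carrier) : ‖rmul ω a‖ = ‖ω‖ * ‖a‖ := by
  have h : ‖rmul ω a‖ ^ 2 = (‖ω‖ * ‖a‖) ^ 2 := by
    rw [mul_pow, PiLp.norm_sq_eq_of_L2, PiLp.norm_sq_eq_of_L2, Finset.sum_mul]
    refine Finset.sum_congr rfl fun i _ => ?_
    change ‖ω i * a‖ ^ 2 = _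
    rw [norm_mul, mul_pow]
  exact (sq_eq_sq₀ (norm_nonneg _) (by positivity)).1 h

/-- The point `ω z ∈ S^d` for `ω ∈ S^d` and `z ∈ S^k`. -/
def sphMul {n : ℕ} (ω : 𝔽.Sph n) (z : 𝔽.UnitSph) : 𝔽.Sph n :=
  ⟨rmul ω.1 z.1, by
    rw [mem_sphere_zero_iff_norm, norm_rmul, norm_eq_of_mem_sphere, norm_eq_of_mem_sphere,
      mul_one]⟩

/-! ### Projective spaces and the projective maps -/

open Classical in
/-- The class `[ω] ⊂ S^d`: it is `{((ω ω̄_{n+1}) z) / |ω_{n+1}| : z ∈ S^k}` if `ω_{n+1} ≠ 0`,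
and `{ω z : z ∈ S^k}` otherwise. -/
def projClass {n : ℕ} (ω : 𝔽.Sph n) : Set (𝔽.Sph n) :=
  if ω.1 (Fin.last n) ≠ 0 then
    {η | ∃ z : 𝔽.UnitSph,
      η.1 = ‖ω.1 (Fin.last n)‖⁻¹ • rmul (rmul ω.1 (star (ω.1 (Fin.last n)))) z.1}
  else {η | ∃ z : 𝔽.UnitSph, η.1 = rmul ω.1 z.1}

variable (𝔽) in
/-- The projective space `𝔽Pⁿ`, the set of all classes `[ω]`, `ω ∈ S^d`. -/
def Proj (n : ℕ) : Type := Set.range (projClass (𝔽 := 𝔽) (n := n))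

variable (𝔽) in
/-- The `𝔽`-projective map `S^d → 𝔽Pⁿ`, `ω ↦ [ω]`. -/
def projMap (n : ℕ) : 𝔽.Sph n → 𝔽.Proj n := fun ω => ⟨projClass ω, ω, rfl⟩

/-- The quotient topology. -/
instance (n : ℕ) : TopologicalSpace (𝔽.Proj n) :=
  TopologicalSpace.coinduced (projMap 𝔽 n) inferInstance

instance (n : ℕ) : MeasurableSpace (𝔽.Proj n) := borel _

instance (n : ℕ) : BorelSpace (𝔽.Proj n) := ⟨rfl⟩

/-! ### Hopf maps -/

/-- `(ω₁, ω₂) ↦ (|ω₁|² - |ω₂|², 2 ω₁ ω̄₂)` as a map `𝔽² → ℝ × 𝔽`. -/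
def hopfFun (ω : 𝔽.Vec 1) : 𝔽.HopfVec :=
  WithLp.toLp 2 (‖ω 0‖ ^ 2 - ‖ω 1‖ ^ 2, (2 : ℝ) • (ω 0 * star (ω 1)))

theorem norm_hopfFun (ω : 𝔽.Vec 1) : ‖hopfFun ω‖ = ‖ω‖ ^ 2 := by
  have h : ‖hopfFun ω‖ ^ 2 = (‖ω‖ ^ 2) ^ 2 := by
    rw [WithLp.prod_norm_sq_eq_of_L2, PiLp.norm_sq_eq_of_L2, Fin.sum_univ_two]
    change ‖‖ω 0‖ ^ 2 - ‖ω 1‖ ^ 2‖ ^ 2 + ‖(2 : ℝ) • (ω 0 * star (ω 1))‖ ^ 2 = _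
    rw [norm_smul, norm_mul, norm_star, Real.norm_eq_abs, sq_abs, Real.norm_ofNat]
    ring
  exact (sq_eq_sq₀ (norm_nonneg _) (by positivity)).1 h

variable (𝔽) in
/-- The `𝔽`-Hopf map `S^{2k+1} ⊂ 𝔽² → S^{k+1} ⊂ ℝ × 𝔽`. -/
def hopfMap (ω : 𝔽.Sph 1) : 𝔽.HopfSph :=
  ⟨hopfFun ω.1, by
    rw [mem_sphere_zero_iff_norm, norm_hopfFun, norm_eq_of_mem_sphere, one_pow]⟩

end DivAlg

/-! ### Polynomials, measures and designs -/

/-- Weighted designs on a measure space `(S, ρ)` for a set `P` of test functions: a finite set `X`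
with positive weights `w` whose weighted sums reproduce the average over `(S, ρ)` of every
`f ∈ P`. Only the values of `w` on `X` matter. -/
def IsWeightedDesign {S : Type*} [MeasurableSpace S] (ρ : Measure S) (P : Set (S → ℝ))
    (X : Finset S) (w : S → ℝ) : Prop :=
  (∀ x ∈ X, 0 < w x) ∧ ∀ f ∈ P, ∑ x ∈ X, w x * f x = ⨍ x, f x ∂ρ

section Sphere

variable (E : Type*) [NormedAddCommGroup E] [InnerProductSpace ℝ E]

/-- `P_t` of the unit sphere of `E`: restrictions to the sphere of real polynomial functions on
`E` of degree at most `t`, a polynomial function on `E` being a polynomial expression in real linear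
functionals (equivalently, in the coordinates with respect to any basis). -/
def spherePoly (t : ℕ) : Set (sphere (0 : E) 1 → ℝ) :=
  {f | ∃ p : MvPolynomial (Module.Dual ℝ E) ℝ, p.totalDegree ≤ t ∧
    ∀ x : sphere (0 : E) 1, f x = MvPolynomial.eval (fun ℓ : Module.Dual ℝ E => ℓ x.1) p}

variable {E} [FiniteDimensional ℝ E] [MeasurableSpace E] [BorelSpace E]

/-- Weighted `t`-designs on the unit sphere of `E` with its standard surface measure. -/
def IsSphericalDesign (t : ℕ) (X : Finset (sphere (0 : E) 1)) (w : sphere (0 : E) 1 → ℝ) : Prop :=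
  IsWeightedDesign (volume : Measure E).toSphere (spherePoly E t) X w

end Sphere

namespace DivAlg

variable {𝔽 : DivAlg}

variable (𝔽) in
/-- The standard measure on `𝔽Pⁿ`, normalized to have the volume of `S^d`: the pushforward of the
surface measure of `S^d` under the projective map. -/
def projMeasure (n : ℕ) : Measure (𝔽.Proj n) :=
  (volume : Measure (𝔽.Vec n)).toSphere.map (projMap 𝔽 n)

variable (𝔽) in
/-- `P_t(𝔽Pⁿ)`: functions whose pullback to `S^d` is in `P_{2t+1}(S^d)`. -/
def projPoly (n t : ℕ) : Set (𝔽.Proj n → ℝ) :=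
  {f | f ∘ projMap 𝔽 n ∈ spherePoly (𝔽.Vec n) (2 * t + 1)}

/-- Weighted `t`-designs on `𝔽Pⁿ`. -/
def IsProjDesign {n : ℕ} (t : ℕ) (Y : Finset (𝔽.Proj n)) (w : 𝔽.Proj n → ℝ) : Prop :=
  IsWeightedDesign (projMeasure 𝔽 n) (projPoly 𝔽 n t) Y w

/-! ### The construction -/

/-- The input of the construction for a map `Π : S^d → Σ`: a finite weighted set `(Y, λ_Y)` in `Σ`
and, for each `y ∈ Y`, a finite weighted set `(Z_y, λ_y)` in `S^k` and a base point
`z_y ∈ Π⁻¹(y)`. Values of `wY`, `Z`, `wZ`, `base` outside `Y` (and of `wZ y` outside `Z y`) are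
irrelevant. -/
structure FibreData {n : ℕ} {S : Type} (proj : 𝔽.Sph n → S) where
  /-- the finite set `Y ⊂ Σ` -/
  Y : Finset S
  /-- the weights `λ_Y` -/
  wY : S → ℝ
  /-- the finite sets `Z_y ⊂ S^k` -/
  Z : S → Finset 𝔽.UnitSph
  /-- the weights `λ_y` -/
  wZ : S → 𝔽.UnitSph → ℝ
  /-- the base points `z_y` -/
  base : S → 𝔽.Sph n
  wY_pos : ∀ y ∈ Y, 0 < wY y
  wZ_pos : ∀ y ∈ Y, ∀ z ∈ Z y, 0 < wZ y z
  proj_base : ∀ y ∈ Y, proj (base y) = y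
  /-- Over the nonassociative algebra `𝕆` the base point has to be one for which multiplication
  `z ↦ z_y z` maps `S^k` into the fibre of `y`. -/
  octonion_fibre : 𝔽 = octonion → ∀ y ∈ Y, ∀ z : 𝔽.UnitSph, proj (sphMul (base y) z) = y

namespace FibreData

variable {n : ℕ} {S : Type} {proj : 𝔽.Sph n → S} (D : FibreData proj)

open Classical in
/-- The part `{z_y z : z ∈ Z_y}` of the constructed set. -/
def part (y : S) : Finset (𝔽.Sph n) := (D.Z y).image (sphMul (D.base y))

open Classical in
/-- The constructed set `X = ⋃_{y ∈ Y} {z_y z : z ∈ Z_y}`. -/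
def X : Finset (𝔽.Sph n) := D.Y.biUnion D.part

open Classical in
/-- The constructed weight: `λ(x)` is the sum of `λ_Y(y) λ_y(z)` over all `y ∈ Y`, `z ∈ Z_y` with
`z_y z = x`. -/
def wX (x : 𝔽.Sph n) : ℝ :=
  ∑ y ∈ D.Y, ∑ z ∈ D.Z y, if sphMul (D.base y) z = x then D.wY y * D.wZ y z else 0

/-- The union defining `X` is disjoint and the weight satisfies `λ(z_y z) = λ_Y(y) λ_y(z)`. -/
def WellDefined : Prop :=
  (D.Y : Set S).PairwiseDisjoint D.part ∧
    ∀ y ∈ D.Y, ∀ z ∈ D.Z y, D.wX (sphMul (D.base y) z) = D.wY y * D.wZ y z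

end FibreData

end DivAlg

end

/-! Polynomials of degree at most `t` on `S^d` are spanned by the powers `⟨v, ω⟩^j`, `j ≤ t`
(`spherePoly_induction`), so these are the only functions to test. Put `A_v(ω) = ∑ ω̄ᵢ vᵢ`
(`fibreAdj`). Then `⟨v, ω z⟩ = ⟨A_v(ω), z⟩`, so averaging over `z ∈ S^k`, or over a `t`-design in
`S^k`, gives `m_j |A_v(ω)|^j`, where `m_j` is a moment of `S^k` that vanishes for odd `j`.

The theorem then rests on two facts about `Π`, combined in `wellDefined_and_design_iff`. Pullback: a
test function of degree `⌊t/2⌋` on `Σ` pulls back to degree `t` on `S^d` with the same average.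
Since the weights over each point sum to 1, a design upstairs therefore gives one downstairs.
Push-forward: `|A_v|^{2s}` is, on the fibres in play, a test function on `Σ` of degree `s`, with the
correct average. This lifts designs from `Σ` to `S^d`.

For associative `𝔽`, `A_v(ω a) = ā A_v(ω)`, so `|A_v|²` descends to `𝔽Pⁿ`. For `n = 1` its
substitute is `hopfForm v ω = (|v|²|ω|² + ⟨π v, π ω⟩)/2`, which is affine in `π ω` on the sphere. It
equals `|A_v(ω)|²` whenever the orbit `ω S^k` lies in a fibre (`norm_fibreAdj_sq_eq_hopfForm`), and
its powers have the right integrals even over `𝕆` (`integral_inner_pow_eq_hopfForm`). The same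
integrals show that `π` preserves averages of polynomials (`integral_comp_hopfMap`). -/

noncomputable section

/-! ### Polynomial functions on spheres and their spanning by powers of linear functionals -/

section SpherePolynomials

variable {E : Type*} [NormedAddCommGroup E] [InnerProductSpace ℝ E]

theorem spherePoly_mono {s t : ℕ} (h : s ≤ t) : spherePoly E s ⊆ spherePoly E t := by
  rintro f ⟨p, hp, hf⟩
  exact ⟨p, hp.trans h, hf⟩

theorem const_mem_spherePoly (c : ℝ) (t : ℕ) : (fun _ => c) ∈ spherePoly E t :=
  ⟨MvPolynomial.C c, by simp, by simp⟩

theorem dual_mem_spherePoly (ℓ : Module.Dual ℝ E) : (fun x => ℓ x.1) ∈ spherePoly E 1 :=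
  ⟨MvPolynomial.X ℓ, by simp, by simp⟩

theorem add_mem_spherePoly {t : ℕ} {f g : sphere (0 : E) 1 → ℝ} (hf : f ∈ spherePoly E t)
    (hg : g ∈ spherePoly E t) : f + g ∈ spherePoly E t := by
  obtain ⟨p, hp, hf⟩ := hf
  obtain ⟨q, hq, hg⟩ := hg
  exact ⟨p + q, (MvPolynomial.totalDegree_add p q).trans (max_le hp hq), by simp [hf, hg]⟩

theorem mul_mem_spherePoly {s t : ℕ} {f g : sphere (0 : E) 1 → ℝ} (hf : f ∈ spherePoly E s)
    (hg : g ∈ spherePoly E t) : f * g ∈ spherePoly E (s + t) := by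
  obtain ⟨p, hp, hf⟩ := hf
  obtain ⟨q, hq, hg⟩ := hg
  exact ⟨p * q, (MvPolynomial.totalDegree_mul p q).trans (add_le_add hp hq), by simp [hf, hg]⟩

theorem smul_mem_spherePoly {t : ℕ} (c : ℝ) {f : sphere (0 : E) 1 → ℝ}
    (hf : f ∈ spherePoly E t) : c • f ∈ spherePoly E t := by
  simpa [Pi.smul_def, Pi.mul_def] using mul_mem_spherePoly (const_mem_spherePoly c 0) hf

theorem pow_mem_spherePoly {s : ℕ} {f : sphere (0 : E) 1 → ℝ} (hf : f ∈ spherePoly E s)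
    (j : ℕ) : f ^ j ∈ spherePoly E (s * j) := by
  induction j with
  | zero => exact const_mem_spherePoly 1 _
  | succ j ih => rw [pow_succ, mul_add, mul_one]; exact mul_mem_spherePoly ih hf

variable (E) in
/-- The space `P_t` of polynomial functions on the unit sphere, as a subspace. -/
def spherePolySubmodule (t : ℕ) : Submodule ℝ (sphere (0 : E) 1 → ℝ) where
  carrier := spherePoly E t
  add_mem' := add_mem_spherePoly
  zero_mem' := const_mem_spherePoly 0 t
  smul_mem' c _ hf := smul_mem_spherePoly c hf

theorem innerPow_mem_spherePoly {j t : ℕ} (h : j ≤ t) (v : E) :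
    (fun x => inner ℝ v x.1 ^ j) ∈ spherePoly E t := by
  have := pow_mem_spherePoly (dual_mem_spherePoly (innerₗ E v)) j
  rw [one_mul] at this
  exact spherePoly_mono h this

/-- A quadratic form is a polynomial of degree two. -/
theorem bilin_mem_spherePoly [FiniteDimensional ℝ E] (B : E →ₗ[ℝ] E →ₗ[ℝ] ℝ) :
    (fun x => B x.1 x.1) ∈ spherePoly E 2 := by
  have b := stdOrthonormalBasis ℝ E
  have h : (fun x : sphere (0 : E) 1 => B x.1 x.1) =
      ∑ i, ∑ j, B (b i) (b j) • ((fun x : sphere (0 : E) 1 => inner ℝ (b i) x.1) *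
        fun x : sphere (0 : E) 1 => inner ℝ (b j) x.1) := by
    funext x
    conv_lhs => rw [← b.sum_repr' x.1]
    simp only [map_sum, LinearMap.sum_apply, map_smul, LinearMap.smul_apply, Finset.sum_apply,
      Pi.smul_apply, Pi.mul_apply, smul_eq_mul, Finset.mul_sum]
    rw [Finset.sum_comm]
    refine Finset.sum_congr rfl fun i _ => Finset.sum_congr rfl fun j _ => ?_
    ring
  rw [h]
  refine Submodule.sum_mem (spherePolySubmodule E 2) fun i _ => Submodule.sum_mem _ fun j _ =>
    Submodule.smul_mem _ _ ?_
  exact mul_mem_spherePoly (dual_mem_spherePoly (innerₗ E (b i)))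
    (dual_mem_spherePoly (innerₗ E (b j)))

/-- The coefficients of a vector-valued polynomial lie in any subspace containing its values. -/
theorem coeff_mem_of_forall_sum_pow_smul_mem {M : Type*} [AddCommGroup M] [Module ℝ M]
    (W : Submodule ℝ M) {N : ℕ} (a : Fin N → M)
    (h : ∀ c : ℝ, ∑ i : Fin N, c ^ (i : ℕ) • a i ∈ W) (i : Fin N) : a i ∈ W := by
  -- Modulo `W` and after applying a functional, the coefficients are scalars, annihilated by the
  -- Vandermonde matrix with nodes `0, …, N - 1`.
  rw [← Submodule.Quotient.mk_eq_zero, ← Module.forall_dual_apply_eq_zero_iff ℝ]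
  intro φ
  have key : (fun i => φ (Submodule.Quotient.mk (a i))) = 0 := by
    refine Matrix.eq_zero_of_forall_index_sum_pow_mul_eq_zero
      (f := fun j : Fin N => ((j : ℕ) : ℝ)) ?_ ?_
    · intro x y hxy
      exact Fin.ext (by simpa using hxy)
    · intro j
      have h1 := (Submodule.Quotient.mk_eq_zero W).2 (h ((j : ℕ) : ℝ))
      have h2 := congrArg φ h1
      rw [← Submodule.mkQ_apply] at h2
      simpa [mul_comm] using h2
  exact congrFun key i

variable (E) in
/-- The span of the `j`-th powers of linear functionals on the unit sphere. -/
def innerPowSpan (j : ℕ) : Submodule ℝ (sphere (0 : E) 1 → ℝ) :=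
  Submodule.span ℝ (Set.range fun (v : E) (x : sphere (0 : E) 1) => inner ℝ v x.1 ^ j)

/-- Polarization: the coefficient of `c` in `⟨v + c u, x⟩^(j+1)` is `(j+1) ⟨u, x⟩ ⟨v, x⟩^j`.
Iterating this brings every monomial into the span of pure powers. -/
theorem inner_mul_mem_innerPowSpan (u : E) {j : ℕ} {f : sphere (0 : E) 1 → ℝ}
    (hf : f ∈ innerPowSpan E j) :
    (fun x : sphere (0 : E) 1 => inner ℝ u x.1) * f ∈ innerPowSpan E (j + 1) := by
  induction hf using Submodule.span_induction with
  | mem f hf =>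
    obtain ⟨v, rfl⟩ := hf
    have key := coeff_mem_of_forall_sum_pow_smul_mem (innerPowSpan E (j + 1))
      (N := j + 2) (fun i => ((j + 1).choose i : ℝ) •
        fun x : sphere (0 : E) 1 => inner ℝ u x.1 ^ (i : ℕ) * inner ℝ v x.1 ^ (j + 1 - i)) ?_ 1
    · have hne : ((j : ℝ) + 1) ≠ 0 := by positivity
      have := Submodule.smul_mem _ ((j : ℝ) + 1)⁻¹ key
      simp only [smul_smul, Fin.val_one, Nat.choose_one_right, pow_one, Nat.add_sub_cancel,
        Nat.cast_add, Nat.cast_one, inv_mul_cancel₀ hne, one_smul] at this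
      exact this
    · intro c
      refine Submodule.subset_span ⟨v + c • u, ?_⟩
      funext x
      simp only [inner_add_left, inner_smul_left, Finset.sum_apply, Pi.smul_apply, smul_eq_mul,
        RCLike.conj_to_real]
      rw [add_comm, add_pow, Finset.sum_range]
      refine Finset.sum_congr rfl fun i _ => ?_
      rw [mul_pow]
      ring
  | zero => simp
  | add f g _ _ hf hg => rw [mul_add]; exact Submodule.add_mem _ hf hg
  | smul c f _ hf => rw [mul_smul_comm]; exact Submodule.smul_mem _ _ hf

theorem dual_pow_mul_mem_innerPowSpan [FiniteDimensional ℝ E] (ℓ : Module.Dual ℝ E) (e : ℕ)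
    {j : ℕ} {f : sphere (0 : E) 1 → ℝ} (hf : f ∈ innerPowSpan E j) :
    (fun x : sphere (0 : E) 1 => ℓ x.1) ^ e * f ∈ innerPowSpan E (e + j) := by
  induction e with
  | zero => simpa using hf
  | succ e ih =>
    have h : ∀ x, ℓ x =
        inner ℝ ((InnerProductSpace.toDual ℝ E).symm (LinearMap.toContinuousLinearMap ℓ)) x := by
      simp
    rw [pow_succ', mul_assoc, add_right_comm]
    have := inner_mul_mem_innerPowSpan
      ((InnerProductSpace.toDual ℝ E).symm (LinearMap.toContinuousLinearMap ℓ)) ih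
    simp only [← h] at this
    exact this

theorem monomial_mem_innerPowSpan [FiniteDimensional ℝ E] (d : Module.Dual ℝ E → ℕ)
    (s : Finset (Module.Dual ℝ E)) :
    (fun x : sphere (0 : E) 1 => ∏ ℓ ∈ s, ℓ x.1 ^ d ℓ) ∈ innerPowSpan E (∑ ℓ ∈ s, d ℓ) := by
  classical
  induction s using Finset.induction_on with
  | empty => exact Submodule.subset_span ⟨0, by simp⟩
  | insert ℓ s hℓ ih =>
    simp only [Finset.prod_insert hℓ, Finset.sum_insert hℓ]
    exact dual_pow_mul_mem_innerPowSpan ℓ (d ℓ) ih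

/-- Polynomial functions on the sphere are linear combinations of powers of linear functionals. -/
theorem spherePoly_induction [FiniteDimensional ℝ E] {t : ℕ}
    {W : Submodule ℝ (sphere (0 : E) 1 → ℝ)}
    (h : ∀ j ≤ t, ∀ v : E, (fun x : sphere (0 : E) 1 => inner ℝ v x.1 ^ j) ∈ W)
    {f : sphere (0 : E) 1 → ℝ} (hf : f ∈ spherePoly E t) : f ∈ W := by
  obtain ⟨p, hp, hf⟩ := hf
  have hW : ∀ j ≤ t, innerPowSpan E j ≤ W := fun j hj =>
    Submodule.span_le.2 (Set.range_subset_iff.2 (h j hj))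
  have : f = ∑ d ∈ p.support, p.coeff d •
      fun x : sphere (0 : E) 1 => ∏ ℓ ∈ d.support, ℓ x.1 ^ d ℓ := by
    funext x
    rw [hf, MvPolynomial.eval_eq]
    simp
  rw [this]
  exact Submodule.sum_mem _ fun d hd => Submodule.smul_mem _ _
    (hW _ ((MvPolynomial.le_totalDegree hd).trans hp) (monomial_mem_innerPowSpan d d.support))

theorem continuous_of_mem_spherePoly [FiniteDimensional ℝ E] {t : ℕ}
    {f : sphere (0 : E) 1 → ℝ} (hf : f ∈ spherePoly E t) : Continuous f := by
  let W : Submodule ℝ (sphere (0 : E) 1 → ℝ) :=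
    { carrier := {f | Continuous f}
      add_mem' := fun hf hg => hf.add hg
      zero_mem' := continuous_zero
      smul_mem' := fun c _ hf => hf.const_smul c }
  exact spherePoly_induction (W := W) (fun j _ v => by
    change Continuous _
    fun_prop) hf

/-- An even polynomial function of odd degree has smaller degree. -/
theorem mem_spherePoly_of_even [FiniteDimensional ℝ E] {s : ℕ} {f : sphere (0 : E) 1 → ℝ}
    (hf : f ∈ spherePoly E (2 * s + 1)) (heven : ∀ x, f (-x) = f x) :
    f ∈ spherePoly E (2 * s) := by
  -- Symmetrization doubles even powers and kills odd ones, in particular the top degree `2s + 1`;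
  -- on an even function it is multiplication by 2.
  let T : (sphere (0 : E) 1 → ℝ) →ₗ[ℝ] (sphere (0 : E) 1 → ℝ) :=
    { toFun := fun f x => f x + f (-x)
      map_add' := fun f g => by funext x; simp only [Pi.add_apply]; ring
      map_smul' := fun c f => by funext x; simp [mul_add] }
  have h : f ∈ (spherePolySubmodule E (2 * s)).comap T := by
    refine spherePoly_induction (fun j hj v => ?_) hf
    change (fun x : sphere (0 : E) 1 => inner ℝ v x.1 ^ j + inner ℝ v (-x).1 ^ j) ∈
      spherePoly E (2 * s)
    rcases Nat.even_or_odd j with hj' | hj'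
    · have hjs : j ≤ 2 * s := by
        obtain ⟨m, rfl⟩ := hj'
        omega
      have h2 := innerPow_mem_spherePoly hjs v
      simpa [inner_neg_right, hj'.neg_pow, Pi.add_def] using add_mem_spherePoly h2 h2
    · simpa [inner_neg_right, hj'.neg_pow] using const_mem_spherePoly (E := E) 0 (2 * s)
  have h2 : T f = (2 : ℝ) • f := by
    funext x
    change f x + f (-x) = 2 * f x
    rw [heven, two_mul]
  have h3 := smul_mem_spherePoly (2 : ℝ)⁻¹ (Submodule.mem_comap.1 h)
  rwa [h2, smul_smul, inv_mul_cancel₀ two_ne_zero, one_smul] at h3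

end SpherePolynomials

/-! ### Averages over spheres and moments of linear functionals -/

section SphereAverage

variable {E : Type*} [NormedAddCommGroup E] [InnerProductSpace ℝ E]

/-- The self-map of the unit sphere induced by a linear isometry. -/
def sphereMap (e : E ≃ₗᵢ[ℝ] E) (x : sphere (0 : E) 1) : sphere (0 : E) 1 :=
  ⟨e x.1, by rw [mem_sphere_zero_iff_norm, e.norm_map, norm_eq_of_mem_sphere]⟩

theorem continuous_sphereMap (e : E ≃ₗᵢ[ℝ] E) : Continuous (sphereMap e) :=
  (e.continuous.comp continuous_subtype_val).subtype_mk _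

variable [FiniteDimensional ℝ E] [MeasurableSpace E] [BorelSpace E]

variable (E) in
/-- The normalized surface measure of the unit sphere. -/
def sphereProb : Measure (sphere (0 : E) 1) :=
  ((volume : Measure E).toSphere Set.univ)⁻¹ • (volume : Measure E).toSphere

theorem average_toSphere (f : sphere (0 : E) 1 → ℝ) :
    ⨍ x, f x ∂(volume : Measure E).toSphere = ∫ x, f x ∂sphereProb E := rfl

instance [Nontrivial E] : IsProbabilityMeasure (sphereProb E) := by
  have : NeZero (volume : Measure E).toSphere := ⟨Measure.toSphere_ne_zero _⟩
  unfold sphereProb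
  infer_instance

open Pointwise in
-- The surface measure of a set is a multiple of the volume of the cone over it, and a linear
-- isometry carries cones to cones and preserves volume.
theorem measurePreserving_sphereMap_toSphere (e : E ≃ₗᵢ[ℝ] E) :
    MeasurePreserving (sphereMap e) (volume : Measure E).toSphere
      (volume : Measure E).toSphere := by
  refine ⟨(continuous_sphereMap e).measurable, ?_⟩
  ext s hs
  rw [Measure.map_apply (continuous_sphereMap e).measurable hs,
    Measure.toSphere_apply' _ ((continuous_sphereMap e).measurable hs),
    Measure.toSphere_apply' _ hs]
  congr 1
  conv_rhs => rw [← e.measurePreserving.measure_preimage_emb e.toHomeomorph.measurableEmbedding]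
  congr 1
  ext x
  simp only [Set.mem_smul, Set.mem_image, Set.mem_preimage]
  constructor
  · rintro ⟨c, hc, _, ⟨y, hy, rfl⟩, rfl⟩
    exact ⟨c, hc, _, ⟨_, hy, rfl⟩, by simp [sphereMap]⟩
  · rintro ⟨c, hc, _, ⟨y, hy, rfl⟩, h⟩
    have hy' : sphereMap e (sphereMap e.symm y) = y := Subtype.ext (by simp [sphereMap])
    refine ⟨c, hc, _, ⟨sphereMap e.symm y, by rwa [hy'], rfl⟩, e.injective ?_⟩
    rw [← h]
    simp [sphereMap]

theorem integral_sphereMap (e : E ≃ₗᵢ[ℝ] E) {f : sphere (0 : E) 1 → ℝ} (hf : Continuous f) :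
    ∫ x, f (sphereMap e x) ∂sphereProb E = ∫ x, f x ∂sphereProb E := by
  unfold sphereProb
  rw [integral_smul_measure, integral_smul_measure]
  congr 1
  conv_rhs => rw [← (measurePreserving_sphereMap_toSphere e).map_eq]
  exact (integral_map (continuous_sphereMap e).measurable.aemeasurable
    hf.aestronglyMeasurable).symm

instance : CompactSpace (sphere (0 : E) 1) :=
  have : ProperSpace E := FiniteDimensional.proper ℝ _
  inferInstance

theorem integrable_sphereProb [Nontrivial E] {f : sphere (0 : E) 1 → ℝ} (hf : Continuous f) :
    Integrable f (sphereProb E) :=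
  hf.integrable_of_hasCompactSupport (HasCompactSupport.of_compactSpace f)

theorem integral_sphereProb_swap [Nontrivial E] {F : Type*} [NormedAddCommGroup F]
    [InnerProductSpace ℝ F] [FiniteDimensional ℝ F] [MeasurableSpace F] [BorelSpace F]
    [Nontrivial F] {f : sphere (0 : E) 1 → sphere (0 : F) 1 → ℝ}
    (hf : Continuous (Function.uncurry f)) :
    ∫ x, ∫ y, f x y ∂sphereProb F ∂sphereProb E = ∫ y, ∫ x, f x y ∂sphereProb E ∂sphereProb F := by
  have : SecondCountableTopology E := (inferInstance : SecondCountableTopology E)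
  exact integral_integral_swap
    (hf.integrable_of_hasCompactSupport (HasCompactSupport.of_compactSpace _))

/-- The averages over the sphere of powers of linear functionals depend only on their norms. -/
theorem integral_inner_pow_eq_of_norm_eq (j : ℕ) {v w : E} (h : ‖v‖ = ‖w‖) :
    ∫ x, inner ℝ v x.1 ^ j ∂sphereProb E = ∫ x, inner ℝ w x.1 ^ j ∂sphereProb E := by
  have hc : Continuous fun x : sphere (0 : E) 1 => inner ℝ w x.1 ^ j := by fun_prop
  -- For `‖v‖ = ‖w‖`, the reflection in the hyperplane orthogonal to `v - w` takes `v` to `w`.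
  rw [← integral_sphereMap ((ℝ ∙ (v - w))ᗮ).reflection hc]
  refine integral_congr_ae (.of_forall fun x => ?_)
  change inner ℝ v x.1 ^ j = inner ℝ w (((ℝ ∙ (v - w))ᗮ).reflection x.1) ^ j
  rw [← LinearIsometryEquiv.inner_map_map ((ℝ ∙ (v - w))ᗮ).reflection v, Submodule.reflection_sub h]

variable (E) in
/-- The `j`-th moment of the unit sphere in the direction of a unit vector. -/
def sphereMoment [Nontrivial E] (j : ℕ) : ℝ :=
  ∫ x : sphere (0 : E) 1, inner ℝ (exists_norm_eq E zero_le_one).choose x.1 ^ j ∂sphereProb E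

theorem integral_inner_pow [Nontrivial E] (j : ℕ) (v : E) :
    ∫ x, inner ℝ v x.1 ^ j ∂sphereProb E = sphereMoment E j * ‖v‖ ^ j := by
  rw [sphereMoment]
  set e := (exists_norm_eq E zero_le_one).choose
  have he : ‖e‖ = 1 := (exists_norm_eq E zero_le_one).choose_spec
  rw [integral_inner_pow_eq_of_norm_eq j (w := ‖v‖ • e) (by simp [norm_smul, he]),
    ← integral_mul_const]
  refine integral_congr_ae (.of_forall fun x => ?_)
  simp only [inner_smul_left, RCLike.conj_to_real, mul_pow]
  ring

theorem sphereMoment_odd [Nontrivial E] {j : ℕ} (hj : Odd j) : sphereMoment E j = 0 := by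
  obtain ⟨v, hv⟩ := exists_norm_eq E zero_le_one
  have h := integral_inner_pow_eq_of_norm_eq j (v := -v) (w := v) (norm_neg v)
  simp only [inner_neg_left, hj.neg_pow, integral_neg, integral_inner_pow, hv, one_pow,
    mul_one] at h
  linarith

/-- If the moment vanished, almost every `x` would be orthogonal to a whole orthonormal basis. The
moment of `S^k` is a divisor in `integral_hopfForm_pow`. -/
theorem sphereMoment_even_ne_zero [Nontrivial E] (s : ℕ) : sphereMoment E (2 * s) ≠ 0 := by
  intro h0
  have h1 : ∀ v : E, ∀ᵐ x ∂sphereProb E, inner ℝ v x.1 ^ (2 * s) = 0 := by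
    intro v
    have hc : Continuous fun x : sphere (0 : E) 1 => inner ℝ v x.1 ^ (2 * s) := by fun_prop
    have h2 : ∫ x, inner ℝ v x.1 ^ (2 * s) ∂sphereProb E = 0 := by
      rw [integral_inner_pow, h0, zero_mul]
    rw [integral_eq_zero_iff_of_nonneg (fun x => by simpa [pow_mul] using by positivity)
      (integrable_sphereProb hc)] at h2
    exact h2
  have h3 : ∀ᵐ x ∂sphereProb E, ∀ i, inner ℝ (stdOrthonormalBasis ℝ E i) x.1 ^ (2 * s) = 0 :=
    ae_all_iff.2 fun i => h1 _
  obtain ⟨x, hx⟩ := h3.exists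
  have h4 : x.1 = 0 := by
    rw [← (stdOrthonormalBasis ℝ E).sum_repr' x.1]
    exact Finset.sum_eq_zero fun i _ => by rw [eq_zero_of_pow_eq_zero (hx i), zero_smul]
  have h5 := norm_eq_of_mem_sphere x
  rw [h4, norm_zero] at h5
  exact zero_ne_one h5

end SphereAverage

/-! ### Octonion identities, checked in quaternionic components -/

namespace Octonion

theorem ext_iff' {x y : Octonion} : x = y ↔ x.fst = y.fst ∧ x.snd = y.snd := by
  constructor
  · rintro rfl
    exact ⟨rfl, rfl⟩
  · rintro ⟨h1, h2⟩
    exact WithLp.ofLp_injective 2 (Prod.ext h1 h2)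

theorem fst_add (x y : Octonion) : (x + y).fst = x.fst + y.fst := rfl
theorem snd_add (x y : Octonion) : (x + y).snd = x.snd + y.snd := rfl
theorem fst_smul (r : ℝ) (x : Octonion) : (r • x).fst = r • x.fst := rfl
theorem snd_smul (r : ℝ) (x : Octonion) : (r • x).snd = r • x.snd := rfl
theorem fst_star (x : Octonion) : (star x).fst = star x.fst := rfl
theorem snd_star (x : Octonion) : (star x).snd = -x.snd := rfl

theorem inner_def (x y : Octonion) :
    inner ℝ x y = inner ℝ x.fst y.fst + inner ℝ x.snd y.snd :=
  WithLp.prod_inner_apply (𝕜 := ℝ) (E := ℍ[ℝ]) (F := ℍ[ℝ]) x y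

theorem add_mul (a b c : Octonion) : (a + b) * c = a * c + b * c := by
  rw [ext_iff']
  simp only [fst_mul, snd_mul, fst_add, snd_add, star_add]
  constructor <;> noncomm_ring

theorem mul_add (a b c : Octonion) : a * (b + c) = a * b + a * c := by
  rw [ext_iff']
  simp only [fst_mul, snd_mul, fst_add, snd_add]
  constructor <;> noncomm_ring

theorem smul_mul (r : ℝ) (a b : Octonion) : (r • a) * b = r • (a * b) := by
  rw [ext_iff']
  simp only [fst_mul, snd_mul, fst_smul, snd_smul, smul_sub, smul_add,
    smul_mul_assoc, mul_smul_comm, Quaternion.star_smul, and_self]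

theorem mul_smul (r : ℝ) (a b : Octonion) : a * (r • b) = r • (a * b) := by
  rw [ext_iff']
  simp only [fst_mul, snd_mul, fst_smul, snd_smul, smul_sub, smul_add,
    smul_mul_assoc, mul_smul_comm, and_self]

theorem star_add (a b : Octonion) : star (a + b) = star a + star b := by
  rw [ext_iff']
  simp only [fst_star, snd_star, fst_add, snd_add, StarAddMonoid.star_add, neg_add, and_self]

theorem star_smul (r : ℝ) (a : Octonion) : star (r • a) = r • star a := by
  rw [ext_iff']
  simp only [fst_star, snd_star, fst_smul, snd_smul, Quaternion.star_smul, smul_neg,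
    and_self]

theorem inner_mul_left (a x y : Octonion) : inner ℝ (a * x) y = inner ℝ x (star a * y) := by
  simp only [inner_def, Quaternion.inner_def, fst_mul, snd_mul, fst_star, snd_star]
  simp only [Quaternion.re_sub, Quaternion.imI_sub, Quaternion.imJ_sub, Quaternion.imK_sub,
    Quaternion.re_add, Quaternion.imI_add, Quaternion.imJ_add, Quaternion.imK_add,
    Quaternion.re_neg, Quaternion.imI_neg, Quaternion.imJ_neg, Quaternion.imK_neg,
    Quaternion.re_mul, Quaternion.imI_mul, Quaternion.imJ_mul, Quaternion.imK_mul,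
    Quaternion.re_star, Quaternion.imI_star, Quaternion.imJ_star, Quaternion.imK_star]
  ring

theorem inner_mul_right (a x y : Octonion) : inner ℝ (x * a) y = inner ℝ x (y * star a) := by
  simp only [inner_def, Quaternion.inner_def, fst_mul, snd_mul, fst_star, snd_star]
  simp only [Quaternion.re_sub, Quaternion.imI_sub, Quaternion.imJ_sub, Quaternion.imK_sub,
    Quaternion.re_add, Quaternion.imI_add, Quaternion.imJ_add, Quaternion.imK_add,
    Quaternion.re_neg, Quaternion.imI_neg, Quaternion.imJ_neg, Quaternion.imK_neg,
    Quaternion.re_mul, Quaternion.imI_mul, Quaternion.imJ_mul, Quaternion.imK_mul,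
    Quaternion.re_star, Quaternion.imI_star, Quaternion.imJ_star, Quaternion.imK_star]
  ring

theorem star_star (a : Octonion) : star (star a) = a := by
  rw [ext_iff']
  simp only [fst_star, snd_star, _root_.star_star, neg_neg, and_self]

theorem star_mul (a b : Octonion) : star (a * b) = star b * star a := by
  rw [ext_iff']
  simp only [fst_star, snd_star, fst_mul, snd_mul, star_sub, StarMul.star_mul, _root_.star_star,
    star_neg]
  constructor <;> noncomm_ring

theorem mul_star_mk_one (x : Octonion) : x * star (mk 1 0) = x := by
  rw [ext_iff', fst_mul, snd_mul, fst_star, snd_star]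
  simp [mk, fst, snd]

theorem mk_one_mul (x : Octonion) : mk 1 0 * x = x := by
  rw [ext_iff', fst_mul, snd_mul]
  simp [mk, fst, snd]

theorem mul_mk_one (x : Octonion) : x * mk 1 0 = x := by
  rw [ext_iff', fst_mul, snd_mul]
  simp [mk, fst, snd]

end Octonion

/-! ### Identities common to the four division algebras -/

namespace DivAlg

theorem real_inner_mul_left (a x y : ℝ) : inner ℝ (a * x) y = inner ℝ x (star a * y) := by
  simp only [RCLike.inner_apply, RCLike.conj_to_real, star_trivial]
  ring

theorem complex_inner_mul_left (a x y : ℂ) : inner ℝ (a * x) y = inner ℝ x (star a * y) := by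
  simp only [Complex.inner, map_mul, Complex.star_def]
  simp
  ring

theorem real_inner_mul_right (a x y : ℝ) : inner ℝ (x * a) y = inner ℝ x (y * star a) := by
  rw [mul_comm x, mul_comm y, real_inner_mul_left]

theorem complex_inner_mul_right (a x y : ℂ) : inner ℝ (x * a) y = inner ℝ x (y * star a) := by
  rw [mul_comm x, mul_comm y, complex_inner_mul_left]

theorem quaternion_inner_mul_left (a x y : ℍ[ℝ]) :
    inner ℝ (a * x) y = inner ℝ x (star a * y) := by
  simp only [Quaternion.inner_def, Quaternion.re_mul, Quaternion.imI_mul, Quaternion.imJ_mul,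
    Quaternion.imK_mul, Quaternion.re_star, Quaternion.imI_star, Quaternion.imJ_star,
    Quaternion.imK_star]
  ring

theorem quaternion_inner_mul_right (a x y : ℍ[ℝ]) :
    inner ℝ (x * a) y = inner ℝ x (y * star a) := by
  simp only [Quaternion.inner_def, StarMul.star_mul, star_star, mul_assoc]

variable {𝔽 : DivAlg}

protected theorem add_mul (a b c : 𝔽.Carrier) : (a + b) * c = a * c + b * c :=
  match 𝔽, a, b, c with
  | real, a, b, c => _root_.add_mul (R := ℝ) a b c
  | complex, a, b, c => _root_.add_mul (R := ℂ) a b c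
  | quaternion, a, b, c => _root_.add_mul (R := ℍ[ℝ]) a b c
  | octonion, a, b, c => Octonion.add_mul a b c

protected theorem mul_add (a b c : 𝔽.Carrier) : a * (b + c) = a * b + a * c :=
  match 𝔽, a, b, c with
  | real, a, b, c => _root_.mul_add (R := ℝ) a b c
  | complex, a, b, c => _root_.mul_add (R := ℂ) a b c
  | quaternion, a, b, c => _root_.mul_add (R := ℍ[ℝ]) a b c
  | octonion, a, b, c => Octonion.mul_add a b c

protected theorem smul_mul (r : ℝ) (a b : 𝔽.Carrier) : (r • a) * b = r • (a * b) :=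
  match 𝔽, a, b with
  | real, a, b => smul_mul_assoc (β := ℝ) r a b
  | complex, a, b => smul_mul_assoc (β := ℂ) r a b
  | quaternion, a, b => smul_mul_assoc (β := ℍ[ℝ]) r a b
  | octonion, a, b => Octonion.smul_mul r a b

protected theorem mul_smul (r : ℝ) (a b : 𝔽.Carrier) : a * (r • b) = r • (a * b) :=
  match 𝔽, a, b with
  | real, a, b => mul_smul_comm (β := ℝ) r a b
  | complex, a, b => mul_smul_comm (β := ℂ) r a b
  | quaternion, a, b => mul_smul_comm (β := ℍ[ℝ]) r a b
  | octonion, a, b => Octonion.mul_smul r a b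

protected theorem star_add (a b : 𝔽.Carrier) : star (a + b) = star a + star b :=
  match 𝔽, a, b with
  | real, a, b => StarAddMonoid.star_add (R := ℝ) a b
  | complex, a, b => StarAddMonoid.star_add (R := ℂ) a b
  | quaternion, a, b => StarAddMonoid.star_add (R := ℍ[ℝ]) a b
  | octonion, a, b => Octonion.star_add a b

protected theorem star_smul (r : ℝ) (a : 𝔽.Carrier) : star (r • a) = r • star a :=
  match 𝔽, a with
  | real, a => StarModule.star_smul (A := ℝ) r a
  | complex, a => StarModule.star_smul (A := ℂ) r a
  | quaternion, a => Quaternion.star_smul (R := ℝ) r a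
  | octonion, a => Octonion.star_smul r a

protected theorem star_star (a : 𝔽.Carrier) : star (star a) = a :=
  match 𝔽, a with
  | real, a => _root_.star_star (R := ℝ) a
  | complex, a => _root_.star_star (R := ℂ) a
  | quaternion, a => _root_.star_star (R := ℍ[ℝ]) a
  | octonion, a => Octonion.star_star a

/-- The adjoint of left multiplication is left multiplication by the conjugate. -/
theorem inner_mul_left (a x y : 𝔽.Carrier) : inner ℝ (a * x) y = inner ℝ x (star a * y) :=
  match 𝔽, a, x, y with
  | real, a, x, y => real_inner_mul_left a x y
  | complex, a, x, y => complex_inner_mul_left a x y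
  | quaternion, a, x, y => quaternion_inner_mul_left a x y
  | octonion, a, x, y => Octonion.inner_mul_left a x y

/-- The adjoint of right multiplication is right multiplication by the conjugate. -/
theorem inner_mul_right (a x y : 𝔽.Carrier) : inner ℝ (x * a) y = inner ℝ x (y * star a) :=
  match 𝔽, a, x, y with
  | real, a, x, y => real_inner_mul_right a x y
  | complex, a, x, y => complex_inner_mul_right a x y
  | quaternion, a, x, y => quaternion_inner_mul_right a x y
  | octonion, a, x, y => Octonion.inner_mul_right a x y

variable (𝔽) in
/-- There is a unit whose conjugate is also a right unit. -/
theorem exists_unit : ∃ e : 𝔽.Carrier, ∀ x, e * x = x ∧ x * e = x ∧ x * star e = x :=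
  match 𝔽 with
  | real => ⟨(1 : ℝ), fun x => ⟨one_mul (M := ℝ) x, mul_one (M := ℝ) x, by
      have h : ∀ x : ℝ, x * star (1 : ℝ) = x := by simp
      exact h x⟩⟩
  | complex => ⟨(1 : ℂ), fun x => ⟨one_mul (M := ℂ) x, mul_one (M := ℂ) x, by
      have h : ∀ x : ℂ, x * star (1 : ℂ) = x := by simp
      exact h x⟩⟩
  | quaternion => ⟨(1 : ℍ[ℝ]), fun x => ⟨one_mul (M := ℍ[ℝ]) x, mul_one (M := ℍ[ℝ]) x, by
      have h : ∀ x : ℍ[ℝ], x * star (1 : ℍ[ℝ]) = x := by simp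
      exact h x⟩⟩
  | octonion => ⟨Octonion.mk 1 0, fun x => ⟨Octonion.mk_one_mul x, Octonion.mul_mk_one x, Octonion.mul_star_mk_one x⟩⟩

theorem mul_assoc_of_ne (h : 𝔽 ≠ octonion) (a b c : 𝔽.Carrier) : a * b * c = a * (b * c) :=
  match 𝔽, h, a, b, c with
  | real, _, a, b, c => mul_assoc (G := ℝ) a b c
  | complex, _, a, b, c => mul_assoc (G := ℂ) a b c
  | quaternion, _, a, b, c => mul_assoc (G := ℍ[ℝ]) a b c
  | octonion, h, _, _, _ => absurd rfl h

protected theorem star_mul (a b : 𝔽.Carrier) : star (a * b) = star b * star a :=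
  match 𝔽, a, b with
  | real, a, b => StarMul.star_mul (R := ℝ) a b
  | complex, a, b => StarMul.star_mul (R := ℂ) a b
  | quaternion, a, b => StarMul.star_mul (R := ℍ[ℝ]) a b
  | octonion, a, b => Octonion.star_mul a b

instance : Nontrivial 𝔽.Carrier :=
  match 𝔽 with
  | real => inferInstanceAs (Nontrivial ℝ)
  | complex => inferInstanceAs (Nontrivial ℂ)
  | quaternion => inferInstanceAs (Nontrivial ℍ[ℝ])
  | octonion => inferInstanceAs (Nontrivial (WithLp 2 (ℍ[ℝ] × ℍ[ℝ])))

protected theorem zero_mul (a : 𝔽.Carrier) : 0 * a = 0 := by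
  simpa using DivAlg.smul_mul 0 0 a

protected theorem mul_zero (a : 𝔽.Carrier) : a * 0 = 0 := by
  simpa using DivAlg.mul_smul 0 a 0

protected theorem star_zero : star (0 : 𝔽.Carrier) = 0 := by
  simpa using DivAlg.star_smul 0 (0 : 𝔽.Carrier)

protected theorem neg_mul (a b : 𝔽.Carrier) : -a * b = -(a * b) := by
  rw [← neg_one_smul ℝ a, DivAlg.smul_mul, neg_one_smul]

protected theorem mul_neg (a b : 𝔽.Carrier) : a * -b = -(a * b) := by
  rw [← neg_one_smul ℝ b, DivAlg.mul_smul, neg_one_smul]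

protected theorem star_neg (a : 𝔽.Carrier) : star (-a) = -star a := by
  rw [← neg_one_smul ℝ a, DivAlg.star_smul, neg_one_smul]

/-- Polarization of `‖a x‖ = ‖a‖ ‖x‖`; no associativity is involved. -/
theorem inner_mul_mul_left (a x y : 𝔽.Carrier) :
    inner ℝ (a * x) (a * y) = ‖a‖ ^ 2 * inner ℝ x y := by
  rw [real_inner_eq_norm_add_mul_self_sub_norm_mul_self_sub_norm_mul_self_div_two,
    real_inner_eq_norm_add_mul_self_sub_norm_mul_self_sub_norm_mul_self_div_two,
    ← DivAlg.mul_add]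
  simp only [norm_mul]
  ring

theorem inner_mul_mul_right (a x y : 𝔽.Carrier) :
    inner ℝ (x * a) (y * a) = ‖a‖ ^ 2 * inner ℝ x y := by
  rw [real_inner_eq_norm_add_mul_self_sub_norm_mul_self_sub_norm_mul_self_div_two,
    real_inner_eq_norm_add_mul_self_sub_norm_mul_self_sub_norm_mul_self_div_two,
    ← DivAlg.add_mul]
  simp only [norm_mul]
  ring

/-- Pairing with `y` and moving `ā` across reduces this to `inner_mul_mul_left`. Together with its
variants below, this is the part of associativity that survives over `𝕆`. -/
theorem star_mul_mul_cancel (a x : 𝔽.Carrier) : star a * (a * x) = ‖a‖ ^ 2 • x := by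
  refine ext_inner_right ℝ fun y => ?_
  rw [inner_mul_left, DivAlg.star_star, inner_mul_mul_left, inner_smul_left, RCLike.conj_to_real]

theorem mul_star_mul_cancel (a x : 𝔽.Carrier) : a * (star a * x) = ‖a‖ ^ 2 • x := by
  have h := star_mul_mul_cancel (star a) x
  rwa [DivAlg.star_star, norm_star] at h

theorem mul_mul_star_cancel (x a : 𝔽.Carrier) : x * a * star a = ‖a‖ ^ 2 • x := by
  refine ext_inner_right ℝ fun y => ?_
  rw [inner_mul_right, DivAlg.star_star, inner_mul_mul_right, inner_smul_left,
    RCLike.conj_to_real]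

theorem mul_star_mul_cancel_right (x a : 𝔽.Carrier) : x * star a * a = ‖a‖ ^ 2 • x := by
  have h := mul_mul_star_cancel x (star a)
  rwa [DivAlg.star_star, norm_star] at h

theorem mul_star_self_mul (a x : 𝔽.Carrier) : a * star a * x = ‖a‖ ^ 2 • x := by
  obtain ⟨e, he⟩ := exists_unit 𝔽
  have h : a * star a = ‖a‖ ^ 2 • e := by
    refine ext_inner_right ℝ fun y => ?_
    rw [inner_mul_right, DivAlg.star_star, inner_smul_left, RCLike.conj_to_real,
      ← inner_mul_mul_right, (he a).1]
  rw [h, DivAlg.smul_mul, (he x).1]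

/-! ### Averaging linear functionals along the orbits of `S^k` -/

variable {n : ℕ}

variable (𝔽) in
/-- Conjugation as a linear map. -/
def starₗ : 𝔽.Carrier →ₗ[ℝ] 𝔽.Carrier where
  toFun := star
  map_add' := DivAlg.star_add
  map_smul' := DivAlg.star_smul

variable (𝔽) in
/-- Multiplication as a continuous bilinear map. -/
def mulL : 𝔽.Carrier →L[ℝ] 𝔽.Carrier →L[ℝ] 𝔽.Carrier :=
  LinearMap.mkContinuous₂ (LinearMap.mk₂ ℝ (fun a b : 𝔽.Carrier => a * b) DivAlg.add_mul
    DivAlg.smul_mul DivAlg.mul_add DivAlg.mul_smul) 1 fun a b => by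
      rw [one_mul]
      exact (norm_mul 𝔽 a b).le

theorem mulL_apply (a b : 𝔽.Carrier) : mulL 𝔽 a b = a * b := rfl

theorem continuous_star : Continuous (star : 𝔽.Carrier → 𝔽.Carrier) :=
  (starₗ 𝔽).continuous_of_finiteDimensional

theorem continuous_mul : Continuous fun p : 𝔽.Carrier × 𝔽.Carrier => p.1 * p.2 :=
  (mulL 𝔽).continuous₂

/-- Right multiplication by a unit element as a linear isometry of `𝔽^{n+1}`. -/
def rmulIsometry (z : 𝔽.UnitSph) : 𝔽.Vec n ≃ₗᵢ[ℝ] 𝔽.Vec n :=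
  LinearIsometry.toLinearIsometryEquiv
    { toFun := fun ω => rmul ω z.1
      map_add' := fun ω η => PiLp.ext fun i => DivAlg.add_mul (ω i) (η i) z.1
      map_smul' := fun r ω => PiLp.ext fun i => DivAlg.smul_mul r (ω i) z.1
      norm_map' := fun ω => by
        change ‖rmul ω z.1‖ = ‖ω‖
        rw [norm_rmul, norm_eq_of_mem_sphere, mul_one] } rfl

/-- For fixed `v`, the vector `∑ i, ω̄ᵢ vᵢ` as a linear function of `ω`: as a function of `v` it is
the adjoint of `z ↦ ω z`. -/
def fibreAdj (v : 𝔽.Vec n) : 𝔽.Vec n →ₗ[ℝ] 𝔽.Carrier where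
  toFun ω := ∑ i, star (ω i) * v i
  map_add' ω η := by
    rw [← Finset.sum_add_distrib]
    refine Finset.sum_congr rfl fun i _ => ?_
    rw [PiLp.add_apply, DivAlg.star_add, DivAlg.add_mul]
  map_smul' r ω := by
    rw [RingHom.id_apply, Finset.smul_sum]
    refine Finset.sum_congr rfl fun i _ => ?_
    rw [PiLp.smul_apply, DivAlg.star_smul, DivAlg.smul_mul]

theorem fibreAdj_apply (v ω : 𝔽.Vec n) : fibreAdj v ω = ∑ i, star (ω i) * v i := rfl

/-- Along an orbit, the functional `⟨v, ·⟩` becomes a linear functional of `z`, so a design on `S^k`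
can evaluate its powers. -/
theorem inner_rmul (v ω : 𝔽.Vec n) (z : 𝔽.Carrier) :
    inner ℝ v (rmul ω z) = inner ℝ (fibreAdj v ω) z := by
  rw [PiLp.inner_apply, fibreAdj_apply, sum_inner]
  refine Finset.sum_congr rfl fun i _ => ?_
  change inner ℝ (v i) (ω i * z) = _
  rw [inner_mul_left, DivAlg.star_star]

theorem continuous_fibreAdj (v : 𝔽.Vec n) : Continuous (fibreAdj v) :=
  (fibreAdj v).continuous_of_finiteDimensional

theorem norm_fibreAdj_sq_mem_spherePoly (v : 𝔽.Vec n) :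
    (fun ω => ‖fibreAdj v ω.1‖ ^ 2) ∈ spherePoly (𝔽.Vec n) 2 := by
  have h := bilin_mem_spherePoly ((innerₗ 𝔽.Carrier).compl₁₂ (fibreAdj v) (fibreAdj v))
  simpa using h

/-- Averaging a power of a linear functional over the fibres. -/
theorem integral_fibre_inner_pow (j : ℕ) (v ω : 𝔽.Vec n) :
    ∫ z, inner ℝ v (rmul ω z.1) ^ j ∂sphereProb 𝔽.Carrier =
      sphereMoment 𝔽.Carrier j * ‖fibreAdj v ω‖ ^ j := by
  simp only [inner_rmul]
  exact integral_inner_pow j _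

/-- Right multiplication by a unit element is an isometry, over `𝕆` as well, so an extra average
over `z ∈ S^k` changes nothing; after Fubini the inner integral is the fibre average. -/
theorem integral_inner_pow_eq_fibre (j : ℕ) (v : 𝔽.Vec n) :
    ∫ ω, inner ℝ v ω.1 ^ j ∂sphereProb (𝔽.Vec n) =
      sphereMoment 𝔽.Carrier j * ∫ ω, ‖fibreAdj v ω.1‖ ^ j ∂sphereProb (𝔽.Vec n) := by
  have hc : Continuous fun ω : 𝔽.Sph n => inner ℝ v ω.1 ^ j := by fun_prop
  have h1 : ∫ z : 𝔽.UnitSph, ∫ ω : 𝔽.Sph n, inner ℝ v (rmul ω.1 z.1) ^ j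
      ∂sphereProb (𝔽.Vec n) ∂sphereProb 𝔽.Carrier =
      ∫ ω : 𝔽.Sph n, inner ℝ v ω.1 ^ j ∂sphereProb (𝔽.Vec n) := by
    have h2 : ∀ z : 𝔽.UnitSph, ∫ ω : 𝔽.Sph n, inner ℝ v (rmul ω.1 z.1) ^ j
        ∂sphereProb (𝔽.Vec n) = ∫ ω : 𝔽.Sph n, inner ℝ v ω.1 ^ j ∂sphereProb (𝔽.Vec n) :=
      fun z => integral_sphereMap (rmulIsometry z) hc
    simp only [h2, integral_const, probReal_univ, one_smul]
  rw [← h1, ← integral_const_mul, integral_sphereProb_swap]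
  · simp only [integral_fibre_inner_pow]
  · have hadj := continuous_fibreAdj v
    simp only [inner_rmul, Function.uncurry_def]
    fun_prop

/-! ### Invariance of the projections along the fibres -/

theorem sphMul_injective (ω : 𝔽.Sph n) : Function.Injective (sphMul ω) := by
  intro z z' h
  have h1 : rmul ω.1 (z.1 - z'.1) = 0 := by
    refine PiLp.ext fun i => ?_
    have h2 : ω.1 i * z.1 = ω.1 i * z'.1 := congrArg (fun η : 𝔽.Sph n => η.1 i) h
    change ω.1 i * (z.1 - z'.1) = 0
    rw [sub_eq_add_neg, DivAlg.mul_add, DivAlg.mul_neg, h2, add_neg_cancel]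
  have h3 := norm_rmul ω.1 (z.1 - z'.1)
  rw [h1, norm_zero, norm_eq_of_mem_sphere, one_mul] at h3
  exact Subtype.ext (sub_eq_zero.1 (norm_eq_zero.1 h3.symm))

theorem hopfFun_fst (ω : 𝔽.Vec 1) : (hopfFun ω).fst = ‖ω 0‖ ^ 2 - ‖ω 1‖ ^ 2 := rfl

theorem hopfFun_snd (ω : 𝔽.Vec 1) : (hopfFun ω).snd = (2 : ℝ) • (ω 0 * star (ω 1)) := rfl

theorem hopfFun_congr {ω η : 𝔽.Vec 1} (h0 : ‖ω 0‖ = ‖η 0‖) (h1 : ‖ω 1‖ = ‖η 1‖)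
    (h : ω 0 * star (ω 1) = η 0 * star (η 1)) : hopfFun ω = hopfFun η := by
  unfold hopfFun
  rw [h0, h1, h]

theorem norm_unit (z : 𝔽.UnitSph) : ‖z.1‖ = 1 := norm_eq_of_mem_sphere z

theorem hopfMap_sphMul (h : 𝔽 ≠ octonion) (ω : 𝔽.Sph 1) (z : 𝔽.UnitSph) :
    hopfMap 𝔽 (sphMul ω z) = hopfMap 𝔽 ω := by
  refine Subtype.ext (hopfFun_congr ?_ ?_ ?_)
  · change ‖ω.1 0 * z.1‖ = _
    rw [norm_mul, norm_unit, mul_one]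
  · change ‖ω.1 1 * z.1‖ = _
    rw [norm_mul, norm_unit, mul_one]
  · change ω.1 0 * z.1 * star (ω.1 1 * z.1) = _
    rw [DivAlg.star_mul, ← mul_assoc_of_ne h, mul_mul_star_cancel, norm_unit, one_pow, one_smul]

theorem rmul_rmul (h : 𝔽 ≠ octonion) (ω : 𝔽.Vec n) (a b : 𝔽.Carrier) :
    rmul (rmul ω a) b = rmul ω (a * b) :=
  PiLp.ext fun i => mul_assoc_of_ne h (ω i) a b

/-- The product of two unit elements. -/
def unitMul (a b : 𝔽.UnitSph) : 𝔽.UnitSph :=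
  ⟨a.1 * b.1, by rw [mem_sphere_zero_iff_norm, norm_mul, norm_unit, norm_unit, mul_one]⟩

/-- The conjugate of a unit element. -/
def unitStar (a : 𝔽.UnitSph) : 𝔽.UnitSph :=
  ⟨star a.1, by rw [mem_sphere_zero_iff_norm, norm_star, norm_unit]⟩

theorem projMap_sphMul (h : 𝔽 ≠ octonion) (ω : 𝔽.Sph n) (z : 𝔽.UnitSph) :
    projMap 𝔽 n (sphMul ω z) = projMap 𝔽 n ω := by
  refine Subtype.ext ?_
  change projClass (sphMul ω z) = projClass ω
  have hlast : (sphMul ω z).1 (Fin.last n) = ω.1 (Fin.last n) * z.1 := rfl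
  have hnorm : ‖(sphMul ω z).1 (Fin.last n)‖ = ‖ω.1 (Fin.last n)‖ := by
    rw [hlast, norm_mul, norm_unit, mul_one]
  have hval : (sphMul ω z).1 = rmul ω.1 z.1 := rfl
  by_cases h0 : ω.1 (Fin.last n) = 0
  · have h0' : (sphMul ω z).1 (Fin.last n) = 0 := by
      rw [← norm_eq_zero, hnorm, h0, norm_zero]
    rw [projClass, projClass, if_neg (not_not.2 h0), if_neg (not_not.2 h0')]
    ext η
    constructor
    · rintro ⟨z', h'⟩
      exact ⟨unitMul z z', by rw [h', hval, rmul_rmul h]; rfl⟩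
    · rintro ⟨z', h'⟩
      refine ⟨unitMul (unitStar z) z', ?_⟩
      rw [h', hval, rmul_rmul h]
      change _ = rmul ω.1 (z.1 * (star z.1 * z'.1))
      rw [mul_star_mul_cancel, norm_unit, one_pow, one_smul]
  · have h0' : (sphMul ω z).1 (Fin.last n) ≠ 0 := by
      rwa [← norm_ne_zero_iff, hnorm, norm_ne_zero_iff]
    rw [projClass, projClass, if_pos h0, if_pos h0']
    -- The unit `z` cancels here: `ω z · conj(ω_{n+1} z) = ω (z z̄ ω̄_{n+1})`.
    have key : rmul (sphMul ω z).1 (star ((sphMul ω z).1 (Fin.last n))) =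
        rmul ω.1 (star (ω.1 (Fin.last n))) := by
      rw [hlast, hval, rmul_rmul h, DivAlg.star_mul, mul_star_mul_cancel, norm_unit, one_pow,
        one_smul]
    rw [hnorm, key]

/-- This makes pullbacks from `𝔽Pⁿ` even functions. Only signs are moved, so it covers `𝕆`. -/
theorem projMap_neg (ω : 𝔽.Sph n) : projMap 𝔽 n (-ω) = projMap 𝔽 n ω := by
  refine Subtype.ext ?_
  change projClass (-ω) = projClass ω
  have hrmul : ∀ (η : 𝔽.Vec n) (a : 𝔽.Carrier), rmul (-η) a = -rmul η a := fun η a =>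
    PiLp.ext fun i => DivAlg.neg_mul (η i) a
  have hrmul' : ∀ (η : 𝔽.Vec n) (a : 𝔽.Carrier), rmul η (-a) = -rmul η a := fun η a =>
    PiLp.ext fun i => DivAlg.mul_neg (η i) a
  have hval : (-ω).1 = -ω.1 := rfl
  have hlast : (-ω).1 (Fin.last n) = -ω.1 (Fin.last n) := rfl
  have hiff : (-ω).1 (Fin.last n) ≠ 0 ↔ ω.1 (Fin.last n) ≠ 0 := by rw [hlast, neg_ne_zero]
  by_cases h0 : ω.1 (Fin.last n) ≠ 0
  · rw [projClass, projClass, if_pos h0, if_pos (hiff.2 h0), hlast, hval, norm_neg,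
      DivAlg.star_neg, hrmul, hrmul', neg_neg]
  · rw [projClass, projClass, if_neg h0, if_neg (mt hiff.1 h0)]
    ext η
    constructor
    · rintro ⟨z, hz⟩
      exact ⟨-z, by rw [hz, hval, hrmul]; exact (hrmul' _ _).symm⟩
    · rintro ⟨z, hz⟩
      refine ⟨-z, ?_⟩
      have h1 : (-z).1 = -z.1 := rfl
      rw [hz, hval, hrmul, h1, hrmul', neg_neg]

theorem projClass_nonempty (ω : 𝔽.Sph n) : (projClass ω).Nonempty := by
  obtain ⟨e, he⟩ := exists_norm_eq 𝔽.Carrier zero_le_one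
  have hz : e ∈ sphere (0 : 𝔽.Carrier) 1 := mem_sphere_zero_iff_norm.2 he
  by_cases h0 : ω.1 (Fin.last n) ≠ 0
  · rw [projClass, if_pos h0]
    refine ⟨⟨‖ω.1 (Fin.last n)‖⁻¹ • rmul (rmul ω.1 (star (ω.1 (Fin.last n)))) e, ?_⟩, ⟨e, hz⟩, rfl⟩
    rw [mem_sphere_zero_iff_norm, norm_smul, norm_rmul, norm_rmul, he, norm_star, norm_inv,
      norm_norm, norm_eq_of_mem_sphere, one_mul, mul_one,
      inv_mul_cancel₀ (norm_ne_zero_iff.2 h0)]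
  · rw [projClass, if_neg h0]
    exact ⟨sphMul ω ⟨e, hz⟩, ⟨e, hz⟩, rfl⟩

/-- A function on the sphere that is invariant along each class factors through `𝔽Pⁿ`. -/
theorem eq_of_projMap_eq {α : Type*} {g : 𝔽.Sph n → α}
    (hg : ∀ ω, ∀ η ∈ projClass ω, g η = g ω) {ω ω' : 𝔽.Sph n}
    (h : projMap 𝔽 n ω = projMap 𝔽 n ω') : g ω = g ω' := by
  have h' : projClass ω = projClass ω' := congrArg Subtype.val h
  obtain ⟨η, hη⟩ := projClass_nonempty ω
  rw [← hg ω η hη, hg ω' η (h' ▸ hη)]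

/-- Associativity gives `A_v(ω a) = ā A_v(ω)`, so the norm sees only `|a|`. -/
theorem norm_fibreAdj_of_mem_projClass (h : 𝔽 ≠ octonion) (v : 𝔽.Vec n) (ω η : 𝔽.Sph n)
    (hη : η ∈ projClass ω) : ‖fibreAdj v η.1‖ = ‖fibreAdj v ω.1‖ := by
  have key : ∀ a : 𝔽.Carrier, ‖fibreAdj v (rmul ω.1 a)‖ = ‖a‖ * ‖fibreAdj v ω.1‖ := by
    intro a
    have h1 : fibreAdj v (rmul ω.1 a) = star a * fibreAdj v ω.1 := by
      rw [fibreAdj_apply, fibreAdj_apply, ← mulL_apply (star a), map_sum]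
      refine Finset.sum_congr rfl fun i _ => ?_
      change star (ω.1 i * a) * v i = star a * (star (ω.1 i) * v i)
      rw [DivAlg.star_mul, mul_assoc_of_ne h]
    rw [h1, norm_mul, norm_star]
  by_cases h0 : ω.1 (Fin.last n) ≠ 0
  · rw [projClass, if_pos h0] at hη
    obtain ⟨z, hz⟩ := hη
    rw [hz, rmul_rmul h, map_smul, norm_smul, key, norm_mul, norm_star, norm_unit, norm_inv,
      norm_norm, mul_one, inv_mul_cancel_left₀ (norm_ne_zero_iff.2 h0)]
  · rw [projClass, if_neg h0] at hη
    obtain ⟨z, hz⟩ := hη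
    rw [hz, key, norm_unit, one_mul]

/-- When `ω₂ ≠ 0`, normalization makes the last coordinate of each class member a real multiple of
`z`, so `η₁ η̄₂` only requires `(x z) z̄ = x`, which holds over `𝕆`. -/
theorem hopfMap_of_mem_projClass (ω η : 𝔽.Sph 1) (hη : η ∈ projClass ω) :
    hopfMap 𝔽 η = hopfMap 𝔽 ω := by
  by_cases h0 : ω.1 (Fin.last 1) ≠ 0
  · rw [projClass, if_pos h0] at hη
    obtain ⟨z, hz⟩ := hη
    have hn : ‖ω.1 1‖ ≠ 0 := norm_ne_zero_iff.2 h0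
    have hi : ∀ i, η.1 i = ‖ω.1 1‖⁻¹ • (ω.1 i * star (ω.1 1) * z.1) := fun i => by rw [hz]; rfl
    have hni : ∀ i, ‖η.1 i‖ = ‖ω.1 i‖ := fun i => by
      rw [hi, norm_smul, norm_mul, norm_mul, norm_star, norm_unit, norm_inv, norm_norm, mul_one,
        mul_comm, mul_inv_cancel_right₀ hn]
    refine Subtype.ext (hopfFun_congr (hni 0) (hni 1) ?_)
    have h1 : ω.1 1 * star (ω.1 1) * z.1 = ‖ω.1 1‖ ^ 2 • z.1 :=
      mul_star_self_mul _ _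
    rw [hi, hi, h1, smul_smul, DivAlg.star_smul, DivAlg.smul_mul, DivAlg.mul_smul,
      mul_mul_star_cancel, norm_unit, one_pow, one_smul, smul_smul]
    have h2 : ‖ω.1 1‖⁻¹ * (‖ω.1 1‖⁻¹ * ‖ω.1 1‖ ^ 2) = 1 := by field_simp
    rw [h2, one_smul]
  · rw [projClass, if_neg h0] at hη
    obtain ⟨z, hz⟩ := hη
    have h0' : ω.1 1 = 0 := not_not.1 h0
    have hi : ∀ i, η.1 i = ω.1 i * z.1 := fun i => by rw [hz]; rfl
    have hni : ∀ i, ‖η.1 i‖ = ‖ω.1 i‖ := fun i => by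
      rw [hi, norm_mul, norm_unit, mul_one]
    refine Subtype.ext (hopfFun_congr (hni 0) (hni 1) ?_)
    rw [hi 1, h0', DivAlg.zero_mul, DivAlg.star_zero, DivAlg.mul_zero, DivAlg.mul_zero]

/-! ### The Hopf map -/

theorem inner_hopfVec (u y : 𝔽.HopfVec) :
    inner ℝ u y = u.fst * y.fst + inner ℝ u.snd y.snd := by
  rw [WithLp.prod_inner_apply]
  congr 1
  exact mul_comm _ _

/-- The quadratic form `(|v|² |ω|² + ⟨π v, π ω⟩) / 2` in `ω`. -/
def hopfForm (v ω : 𝔽.Vec 1) : ℝ :=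
  2⁻¹ * (‖v‖ ^ 2 * ‖ω‖ ^ 2 + inner ℝ (hopfFun v) (hopfFun ω))

theorem norm_sq_vec (v : 𝔽.Vec 1) : ‖v‖ ^ 2 = ‖v 0‖ ^ 2 + ‖v 1‖ ^ 2 := by
  rw [PiLp.norm_sq_eq_of_L2, Fin.sum_univ_two]

theorem hopfForm_eq (v ω : 𝔽.Vec 1) :
    hopfForm v ω = ‖v 0‖ ^ 2 * ‖ω 0‖ ^ 2 + ‖v 1‖ ^ 2 * ‖ω 1‖ ^ 2 +
      2 * inner ℝ (v 0 * star (v 1)) (ω 0 * star (ω 1)) := by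
  rw [hopfForm, inner_hopfVec, hopfFun_fst, hopfFun_fst, hopfFun_snd, hopfFun_snd, norm_sq_vec,
    norm_sq_vec, inner_smul_left, inner_smul_right, RCLike.conj_to_real]
  ring

/-- Compared with `hopfForm_eq`, only the cross term differs: `⟨v₁, ω₁(ω̄₂ v₂)⟩` here, `⟨v₁, (ω₁
ω̄₂) v₂⟩` there, after taking adjoints. -/
theorem norm_fibreAdj_sq (v ω : 𝔽.Vec 1) :
    ‖fibreAdj v ω‖ ^ 2 = ‖v 0‖ ^ 2 * ‖ω 0‖ ^ 2 + ‖v 1‖ ^ 2 * ‖ω 1‖ ^ 2 +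
      2 * inner ℝ (star (ω 0) * v 0) (star (ω 1) * v 1) := by
  rw [fibreAdj_apply, Fin.sum_univ_two, norm_add_sq_real, norm_mul, norm_mul, norm_star, norm_star]
  ring

theorem continuous_hopfFun : Continuous (hopfFun : 𝔽.Vec 1 → 𝔽.HopfVec) := by
  refine (WithLp.prod_continuous_toLp 2 _ _).comp (.prodMk (by fun_prop) (.const_smul ?_ _))
  exact continuous_mul.comp (.prodMk (by fun_prop) (continuous_star.comp (by fun_prop)))

theorem continuous_hopfMap : Continuous (hopfMap 𝔽) :=
  (continuous_hopfFun.comp continuous_subtype_val).subtype_mk _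

theorem inner_hopfFun_mem_spherePoly (u : 𝔽.HopfVec) :
    (fun ω : 𝔽.Sph 1 => inner ℝ u (hopfFun ω.1)) ∈ spherePoly (𝔽.Vec 1) 2 := by
  let p (i : Fin 2) : 𝔽.Vec 1 →ₗ[ℝ] 𝔽.Carrier := (PiLp.proj 2 (fun _ => 𝔽.Carrier) i : _ →L[ℝ] _)
  let M : 𝔽.Carrier →ₗ[ℝ] 𝔽.Carrier →ₗ[ℝ] ℝ :=
    LinearMap.mk₂ ℝ (fun a b => inner ℝ u.snd (a * star b))
      (fun a b c => by rw [DivAlg.add_mul, inner_add_right])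
      (fun r a b => by rw [DivAlg.smul_mul, inner_smul_right, smul_eq_mul])
      (fun a b c => by rw [DivAlg.star_add, DivAlg.mul_add, inner_add_right])
      (fun r a b => by rw [DivAlg.star_smul, DivAlg.mul_smul, inner_smul_right, smul_eq_mul])
  have h := bilin_mem_spherePoly (u.fst • ((innerₗ 𝔽.Carrier).compl₁₂ (p 0) (p 0) -
    (innerₗ 𝔽.Carrier).compl₁₂ (p 1) (p 1)) + (2 : ℝ) • M.compl₁₂ (p 0) (p 1))
  convert h using 1
  funext ω
  rw [inner_hopfVec, hopfFun_fst, hopfFun_snd, inner_smul_right, ← real_inner_self_eq_norm_sq,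
    ← real_inner_self_eq_norm_sq]
  rfl

theorem comp_hopfMap_mem_spherePoly {s : ℕ} {f : 𝔽.HopfSph → ℝ}
    (hf : f ∈ spherePoly 𝔽.HopfVec s) : f ∘ hopfMap 𝔽 ∈ spherePoly (𝔽.Vec 1) (2 * s) := by
  refine spherePoly_induction (W := (spherePolySubmodule (𝔽.Vec 1) (2 * s)).comap
    (LinearMap.funLeft ℝ ℝ (hopfMap 𝔽))) (fun j hj u => ?_) hf
  exact spherePoly_mono (Nat.mul_le_mul_left 2 hj)
    (pow_mem_spherePoly (inner_hopfFun_mem_spherePoly u) j)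

/-- On a fibre that is an orbit of right multiplication, the two quadratic forms agree. -/
theorem norm_fibreAdj_sq_eq_hopfForm {ω : 𝔽.Sph 1}
    (hω : ∀ z, hopfMap 𝔽 (sphMul ω z) = hopfMap 𝔽 ω) (v : 𝔽.Vec 1) :
    ‖fibreAdj v ω.1‖ ^ 2 = hopfForm v ω.1 := by
  set a := ω.1 0
  set b := ω.1 1
  -- Invariance of the second Hopf component reads `(a z) conj(b z) = a b̄`; multiply it on the
  -- right by `b z`.
  have hq : ∀ z, ‖z‖ = 1 → ‖b‖ ^ 2 • (a * z) = a * star b * (b * z) := by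
    intro z hz
    have h1 := congrArg (fun y : 𝔽.HopfSph => y.1.snd) (hω ⟨z, mem_sphere_zero_iff_norm.2 hz⟩)
    have h2 : (2 : ℝ) • (a * z * star (b * z)) = (2 : ℝ) • (a * star b) := h1
    have h3 := smul_right_injective _ (two_ne_zero (α := ℝ)) h2
    rw [← h3, mul_star_mul_cancel_right, norm_mul, hz, mul_one]
  have hq' : ∀ z, ‖b‖ ^ 2 • (a * z) = a * star b * (b * z) := by
    intro z
    rcases eq_or_ne z 0 with rfl | hz
    · simp only [DivAlg.mul_zero, smul_zero]
    · have h1 := hq (‖z‖⁻¹ • z) (by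
        rw [norm_smul, norm_inv, norm_norm, inv_mul_cancel₀ (norm_ne_zero_iff.2 hz)])
      rw [DivAlg.mul_smul, DivAlg.mul_smul, DivAlg.mul_smul, smul_comm] at h1
      exact smul_right_injective _ (inv_ne_zero (norm_ne_zero_iff.2 hz)) h1
  -- Taking `z = b̄ x` yields exactly the associativity that identifies the two cross terms.
  have hassoc : ∀ x, a * (star b * x) = a * star b * x := by
    intro x
    rcases eq_or_ne b 0 with hb | hb
    · rw [hb, DivAlg.star_zero, DivAlg.zero_mul, DivAlg.mul_zero, DivAlg.zero_mul]
    · have h1 := hq' (star b * x)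
      rw [mul_star_mul_cancel, DivAlg.mul_smul] at h1
      exact smul_right_injective _ (pow_ne_zero 2 (norm_ne_zero_iff.2 hb)) h1
  rw [norm_fibreAdj_sq, hopfForm_eq, inner_mul_left, DivAlg.star_star, inner_mul_right,
    DivAlg.star_star, hassoc]

theorem norm_eq_one_of_mul_eq {e : 𝔽.Carrier} (he : ∀ x, e * x = x) : ‖e‖ = 1 := by
  obtain ⟨x, hx⟩ := exists_norm_eq 𝔽.Carrier zero_le_one
  have h := congrArg norm (he x)
  rwa [norm_mul, hx, mul_one] at h

/-- Every vector has the same norm and Hopf image as one with real last coordinate. -/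
theorem exists_norm_fibreAdj_sq_eq_hopfForm (v : 𝔽.Vec 1) :
    ∃ v' : 𝔽.Vec 1, ‖v'‖ = ‖v‖ ∧ hopfFun v' = hopfFun v ∧
      ∀ ω, ‖fibreAdj v' ω‖ ^ 2 = hopfForm v' ω := by
  obtain ⟨e, he⟩ := exists_unit 𝔽
  -- A real last coordinate of `v'` factors out of both cross terms, leaving no triple product to
  -- reassociate.
  have hreal : ∀ (v' : 𝔽.Vec 1) (r : ℝ), v' 1 = r • e →
      ∀ ω, ‖fibreAdj v' ω‖ ^ 2 = hopfForm v' ω := by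
    intro v' r hr ω
    rw [norm_fibreAdj_sq, hopfForm_eq, hr, DivAlg.mul_smul, DivAlg.star_smul, DivAlg.mul_smul,
      (he _).2.1, (he _).2.2, inner_smul_right, inner_smul_left, RCLike.conj_to_real,
      inner_mul_left, DivAlg.star_star]
  have hne : ‖e‖ = 1 := norm_eq_one_of_mul_eq fun x => (he x).1
  rcases eq_or_ne (v 1) 0 with hv | hv
  · exact ⟨v, rfl, rfl, hreal v 0 (by rw [hv, zero_smul])⟩
  · have hv' : ‖v 1‖ ≠ 0 := norm_ne_zero_iff.2 hv
    -- This is `v` multiplied on the right by `v̄₂ / |v₂|`, which makes the last coordinate `|v₂|`.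
    let v' : 𝔽.Vec 1 := WithLp.toLp 2 ![‖v 1‖⁻¹ • (v 0 * star (v 1)), ‖v 1‖ • e]
    have h0 : v' 0 = ‖v 1‖⁻¹ • (v 0 * star (v 1)) := rfl
    have h1 : v' 1 = ‖v 1‖ • e := rfl
    have hn0 : ‖v' 0‖ = ‖v 0‖ := by
      rw [h0, norm_smul, norm_mul, norm_star, norm_inv, norm_norm, mul_comm,
        mul_inv_cancel_right₀ hv']
    have hn1 : ‖v' 1‖ = ‖v 1‖ := by rw [h1, norm_smul, norm_norm, hne, mul_one]
    refine ⟨v', ?_, hopfFun_congr hn0 hn1 ?_, hreal v' _ h1⟩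
    · rw [← sq_eq_sq₀ (norm_nonneg _) (norm_nonneg _), norm_sq_vec, norm_sq_vec, hn0, hn1]
    · rw [h0, h1, DivAlg.star_smul, DivAlg.mul_smul, (he _).2.2, smul_smul,
        mul_inv_cancel₀ hv', one_smul]

theorem hopfMap_surjective : Function.Surjective (hopfMap 𝔽) := by
  intro u
  obtain ⟨e, he⟩ := exists_unit 𝔽
  have hne : ‖e‖ = 1 := norm_eq_one_of_mul_eq fun x => (he x).1
  have hu : u.1.fst ^ 2 + ‖u.1.snd‖ ^ 2 = 1 := by
    have h := WithLp.prod_norm_sq_eq_of_L2 u.1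
    rw [norm_eq_of_mem_sphere, Real.norm_eq_abs, sq_abs] at h
    linarith
  suffices h : ∃ v : 𝔽.Vec 1, hopfFun v = u.1 by
    obtain ⟨v, hv⟩ := h
    have hn : ‖v‖ ^ 2 = 1 := by rw [← norm_hopfFun, hv, norm_eq_of_mem_sphere]
    exact ⟨⟨v, mem_sphere_zero_iff_norm.2
      ((sq_eq_sq₀ (norm_nonneg v) zero_le_one).1 (by rw [hn, one_pow]))⟩, Subtype.ext hv⟩
  rcases eq_or_ne u.1.fst 1 with h1 | h1
  · have h2 : u.1.snd = 0 := by
      rw [h1] at hu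
      exact norm_eq_zero.1 (pow_eq_zero_iff two_ne_zero |>.1 (by linarith))
    refine ⟨WithLp.toLp 2 ![e, 0], WithLp.ofLp_injective 2 (Prod.ext ?_ ?_)⟩
    · change ‖e‖ ^ 2 - ‖(0 : 𝔽.Carrier)‖ ^ 2 = u.1.fst
      rw [hne, norm_zero, h1]
      norm_num
    · change (2 : ℝ) • (e * star (0 : 𝔽.Carrier)) = u.1.snd
      rw [DivAlg.star_zero, DivAlg.mul_zero, smul_zero, h2]
  · have hlt : u.1.fst < 1 := lt_of_le_of_ne (by nlinarith [sq_nonneg ‖u.1.snd‖]) h1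
    -- A preimage with real last coordinate `r` must satisfy `|ω₁|² + r² = 1` and `|ω₁|² - r² =
    -- u.fst`, whence `r`; then `2 r ω₁ = u.snd`. The pole `u.fst = 1`, where `r = 0`, was treated
    -- separately.
    set r := √((1 - u.1.fst) / 2)
    have hr : 0 < r := Real.sqrt_pos.2 (by linarith)
    have hr2 : r ^ 2 = (1 - u.1.fst) / 2 := Real.sq_sqrt (by linarith)
    refine ⟨WithLp.toLp 2 ![(2 * r)⁻¹ • u.1.snd, r • e], WithLp.ofLp_injective 2
      (Prod.ext ?_ ?_)⟩
    · change ‖(2 * r)⁻¹ • u.1.snd‖ ^ 2 - ‖r • e‖ ^ 2 = u.1.fst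
      rw [norm_smul, norm_smul, hne, mul_one, mul_pow, Real.norm_eq_abs, Real.norm_eq_abs,
        sq_abs, sq_abs, inv_pow, mul_pow, hr2, (by linarith : ‖u.1.snd‖ ^ 2 = 1 - u.1.fst ^ 2)]
      have : 1 - u.1.fst ≠ 0 := by linarith
      field_simp
      ring
    · change (2 : ℝ) • ((2 * r)⁻¹ • u.1.snd * star (r • e)) = u.1.snd
      rw [DivAlg.star_smul, DivAlg.mul_smul, (he _).2.2, smul_smul, smul_smul]
      have : 2 * r * (2 * r)⁻¹ = 1 := by field_simp
      rw [this, one_smul]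

theorem hopfForm_congr {v v' : 𝔽.Vec 1} (h : ‖v'‖ = ‖v‖) (h' : hopfFun v' = hopfFun v)
    (ω : 𝔽.Vec 1) : hopfForm v' ω = hopfForm v ω := by
  unfold hopfForm
  rw [h, h']

/-- The left side depends only on `‖v‖`, the right only on `‖v‖` and `π v`. So `v` may be replaced
by a vector with real last coordinate, for which `|A_v|²` and `hopfForm v` agree everywhere. Over
`𝕆` they may differ pointwise for the original `v`. -/
theorem integral_inner_pow_eq_hopfForm (s : ℕ) (v : 𝔽.Vec 1) :
    ∫ ω, inner ℝ v ω.1 ^ (2 * s) ∂sphereProb (𝔽.Vec 1) =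
      sphereMoment 𝔽.Carrier (2 * s) * ∫ ω, hopfForm v ω.1 ^ s ∂sphereProb (𝔽.Vec 1) := by
  obtain ⟨v', hn, hh, hv'⟩ := exists_norm_fibreAdj_sq_eq_hopfForm v
  rw [integral_inner_pow_eq_of_norm_eq _ hn.symm, integral_inner_pow_eq_fibre]
  simp only [pow_mul, hv', hopfForm_congr hn hh]

theorem integral_hopfForm_pow (s : ℕ) (v : 𝔽.Sph 1) :
    ∫ ω, hopfForm v.1 ω.1 ^ s ∂sphereProb (𝔽.Vec 1) =
      sphereMoment (𝔽.Vec 1) (2 * s) / sphereMoment 𝔽.Carrier (2 * s) := by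
  rw [eq_div_iff (sphereMoment_even_ne_zero s), mul_comm, ← integral_inner_pow_eq_hopfForm,
    integral_inner_pow, norm_eq_of_mem_sphere, one_pow, mul_one]

/-- With `u = π v`, one has `⟨π v, π ω⟩ = 2 hopfForm v ω - 1` on unit vectors; in the binomial
expansion every integral is independent of `v` by `integral_hopfForm_pow`. -/
theorem exists_integral_inner_hopfMap_pow (j : ℕ) :
    ∃ c : ℝ, ∀ u : 𝔽.HopfSph,
      ∫ ω, inner ℝ u.1 (hopfMap 𝔽 ω).1 ^ j ∂sphereProb (𝔽.Vec 1) = c := by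
  refine ⟨∑ i ∈ Finset.range (j + 1), 2 ^ i * (sphereMoment (𝔽.Vec 1) (2 * i) /
    sphereMoment 𝔽.Carrier (2 * i)) * (-1) ^ (j - i) * j.choose i, fun u => ?_⟩
  obtain ⟨v, rfl⟩ := hopfMap_surjective u
  have h1 : ∀ ω : 𝔽.Sph 1, inner ℝ (hopfMap 𝔽 v).1 (hopfMap 𝔽 ω).1 =
      2 * hopfForm v.1 ω.1 + -1 := by
    intro ω
    change inner ℝ (hopfFun v.1) (hopfFun ω.1) = _
    rw [hopfForm, norm_eq_of_mem_sphere, norm_eq_of_mem_sphere]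
    ring
  have hc : Continuous fun ω : 𝔽.Sph 1 => hopfForm v.1 ω.1 := by
    have : Continuous fun ω : 𝔽.Sph 1 => hopfFun ω.1 :=
      continuous_hopfFun.comp continuous_subtype_val
    unfold hopfForm
    fun_prop
  simp only [h1, add_pow]
  rw [integral_finsetSum _ fun i _ => integrable_sphereProb (by fun_prop)]
  refine Finset.sum_congr rfl fun i _ => ?_
  simp only [mul_pow]
  rw [integral_mul_const, integral_mul_const, integral_const_mul, integral_hopfForm_pow]

/-- The Hopf map pushes the uniform measure forward to the uniform measure, tested on
polynomials. -/
theorem integral_comp_hopfMap {s : ℕ} {f : 𝔽.HopfSph → ℝ} (hf : f ∈ spherePoly 𝔽.HopfVec s) :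
    ∫ ω, f (hopfMap 𝔽 ω) ∂sphereProb (𝔽.Vec 1) = ∫ y, f y ∂sphereProb 𝔽.HopfVec := by
  have hcont := continuous_hopfMap (𝔽 := 𝔽)
  have key : ∀ (j : ℕ) (u : 𝔽.HopfSph),
      ∫ ω, inner ℝ u.1 (hopfMap 𝔽 ω).1 ^ j ∂sphereProb (𝔽.Vec 1) =
        sphereMoment 𝔽.HopfVec j := by
    intro j u
    obtain ⟨c, hc⟩ := exists_integral_inner_hopfMap_pow (𝔽 := 𝔽) j
    rw [hc]
    -- Averaging the constant `c` over `u` as well and integrating over `u` first identifies it as a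
    -- moment of `S^{k+1}`.
    have h1 : ∫ u : 𝔽.HopfSph, ∫ ω : 𝔽.Sph 1, inner ℝ u.1 (hopfMap 𝔽 ω).1 ^ j
        ∂sphereProb (𝔽.Vec 1) ∂sphereProb 𝔽.HopfVec = c := by
      simp only [hc, integral_const, probReal_univ, one_smul]
    rw [← h1, integral_sphereProb_swap]
    · have h2 : ∀ ω : 𝔽.Sph 1, ∫ u : 𝔽.HopfSph, inner ℝ u.1 (hopfMap 𝔽 ω).1 ^ j
          ∂sphereProb 𝔽.HopfVec = sphereMoment 𝔽.HopfVec j := by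
        intro ω
        simp only [real_inner_comm (hopfMap 𝔽 ω).1]
        rw [integral_inner_pow, norm_eq_of_mem_sphere, one_pow, mul_one]
      simp only [h2, integral_const, probReal_univ, one_smul]
    · have h3 : Continuous fun p : 𝔽.HopfSph × 𝔽.Sph 1 => (hopfMap 𝔽 p.2).1 :=
        continuous_subtype_val.comp (hcont.comp continuous_snd)
      rw [Function.uncurry_def]
      exact ((continuous_subtype_val.comp continuous_fst).inner h3).pow j
  let W : Submodule ℝ (𝔽.HopfSph → ℝ) :=
    { carrier := {f | Continuous f ∧ ∫ ω, f (hopfMap 𝔽 ω) ∂sphereProb (𝔽.Vec 1) =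
        ∫ y, f y ∂sphereProb 𝔽.HopfVec}
      add_mem' := by
        rintro f g ⟨hf, hf'⟩ ⟨hg, hg'⟩
        refine ⟨hf.add hg, ?_⟩
        simp only [Pi.add_apply]
        rw [integral_add (integrable_sphereProb (f := fun ω => f (hopfMap 𝔽 ω))
          (hf.comp hcont)) (integrable_sphereProb (f := fun ω => g (hopfMap 𝔽 ω))
          (hg.comp hcont)), integral_add (integrable_sphereProb hf)
          (integrable_sphereProb hg), hf', hg']
      zero_mem' := ⟨continuous_zero, by simp⟩
      smul_mem' := by
        rintro c f ⟨hf, hf'⟩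
        refine ⟨hf.const_smul c, ?_⟩
        simp only [Pi.smul_apply, integral_smul, hf'] }
  have hmem : f ∈ W := by
    refine spherePoly_induction (W := W) (fun j _ u => ?_) hf
    refine ⟨by fun_prop, ?_⟩
    rw [integral_inner_pow]
    rcases eq_or_ne u 0 with rfl | hu
    · simp only [inner_zero_left, integral_const, probReal_univ, one_smul, norm_zero]
      -- Since `0 ^ 0 = 1`, the case `j = 0` needs the zeroth moment to be 1.
      rcases Nat.eq_zero_or_pos j with rfl | hj
      · obtain ⟨v, hv⟩ := exists_norm_eq 𝔽.HopfVec zero_le_one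
        have := integral_inner_pow 0 v
        simpa using this
      · simp [hj.ne']
    · have hu' : ‖u‖ ≠ 0 := norm_ne_zero_iff.2 hu
      let u' : 𝔽.HopfSph := ⟨‖u‖⁻¹ • u, by
        rw [mem_sphere_zero_iff_norm, norm_smul, norm_inv, norm_norm, inv_mul_cancel₀ hu']⟩
      have h1 : u = ‖u‖ • u'.1 := by rw [smul_smul, mul_inv_cancel₀ hu', one_smul]
      rw [← key j u', mul_comm, ← integral_const_mul]
      refine integral_congr_ae (.of_forall fun ω => ?_)
      change inner ℝ u (hopfMap 𝔽 ω).1 ^ j = ‖u‖ ^ j * inner ℝ u'.1 (hopfMap 𝔽 ω).1 ^ j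
      conv_lhs => rw [h1]
      rw [inner_smul_left, RCLike.conj_to_real, mul_pow]
  exact hmem.2

end DivAlg

/-! ### Transfer of designs along an abstract projection -/

/-- It suffices to test the design property on powers of linear functionals. -/
theorem isSphericalDesign_of_pow {E : Type*} [NormedAddCommGroup E] [InnerProductSpace ℝ E]
    [FiniteDimensional ℝ E] [MeasurableSpace E] [BorelSpace E] [Nontrivial E] {t : ℕ}
    {X : Finset (sphere (0 : E) 1)} {w : sphere (0 : E) 1 → ℝ} (hw : ∀ x ∈ X, 0 < w x)
    (h : ∀ j ≤ t, ∀ v : E, ∑ x ∈ X, w x * inner ℝ v x.1 ^ j =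
      ∫ x, inner ℝ v x.1 ^ j ∂sphereProb E) : IsSphericalDesign t X w := by
  refine ⟨hw, fun f hf => ?_⟩
  rw [average_toSphere]
  let W : Submodule ℝ (sphere (0 : E) 1 → ℝ) :=
    { carrier := {f | Continuous f ∧ ∑ x ∈ X, w x * f x = ∫ x, f x ∂sphereProb E}
      add_mem' := by
        rintro f g ⟨hf, hf'⟩ ⟨hg, hg'⟩
        refine ⟨hf.add hg, ?_⟩
        simp only [Pi.add_apply, mul_add, Finset.sum_add_distrib]
        rw [integral_add (integrable_sphereProb hf) (integrable_sphereProb hg), hf', hg']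
      zero_mem' := ⟨continuous_zero, by simp⟩
      smul_mem' := by
        rintro c f ⟨hf, hf'⟩
        refine ⟨hf.const_smul c, ?_⟩
        simp only [Pi.smul_apply, smul_eq_mul, integral_const_mul, ← hf', Finset.mul_sum]
        exact Finset.sum_congr rfl fun x _ => by ring }
  have hmem : f ∈ W := spherePoly_induction (W := W)
    (fun j hj v => ⟨by fun_prop, h j hj v⟩) hf
  exact hmem.2

namespace DivAlg

variable {𝔽 : DivAlg} {n : ℕ}

namespace FibreData

section

variable {S : Type} {proj : 𝔽.Sph n → S} (D : FibreData proj)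

/-- Points over different `y` are separated by `proj`, points over the same `y` by injectivity of `z
↦ z_y z`. -/
theorem wellDefined (hfib : ∀ y ∈ D.Y, ∀ z, proj (sphMul (D.base y) z) = y) : D.WellDefined := by
  classical
  constructor
  · intro y hy y' hy' hne
    refine Finset.disjoint_left.2 fun x hx hx' => hne ?_
    obtain ⟨z, -, rfl⟩ := Finset.mem_image.1 hx
    obtain ⟨z', -, h⟩ := Finset.mem_image.1 hx'
    rw [← hfib y hy z, ← h, hfib y' hy' z']
  · intro y hy z hz
    rw [wX, Finset.sum_eq_single_of_mem y hy, Finset.sum_eq_single_of_mem z hz, if_pos rfl]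
    · exact fun z' _ hne => if_neg fun h => hne (sphMul_injective _ h)
    · refine fun y' hy' hne => Finset.sum_eq_zero fun z' _ => if_neg fun h => hne ?_
      rw [← hfib y hy z, ← h, hfib y' hy' z']

variable {D}

theorem sum_X (h : D.WellDefined) (g : 𝔽.Sph n → ℝ) :
    ∑ x ∈ D.X, D.wX x * g x =
      ∑ y ∈ D.Y, ∑ z ∈ D.Z y, D.wY y * D.wZ y z * g (sphMul (D.base y) z) := by
  classical
  rw [X, Finset.sum_biUnion h.1]
  refine Finset.sum_congr rfl fun y hy => ?_
  rw [part, Finset.sum_image fun z _ z' _ h' => sphMul_injective _ h']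
  exact Finset.sum_congr rfl fun z hz => by rw [h.2 y hy z hz]

theorem wX_pos (h : D.WellDefined) : ∀ x ∈ D.X, 0 < D.wX x := by
  classical
  intro x hx
  obtain ⟨y, hy, hx⟩ := Finset.mem_biUnion.1 hx
  obtain ⟨z, hz, rfl⟩ := Finset.mem_image.1 hx
  rw [h.2 y hy z hz]
  exact mul_pos (D.wY_pos y hy) (D.wZ_pos y hy z hz)

theorem sum_wZ_of_design {t : ℕ} {y : S} (hZ : IsSphericalDesign t (D.Z y) (D.wZ y)) :
    ∑ z ∈ D.Z y, D.wZ y z = 1 := by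
  have h := hZ.2 _ (const_mem_spherePoly 1 t)
  rw [average_toSphere] at h
  simpa using h

theorem sum_wZ_of_sum_wX (h : D.WellDefined) {y : S} (hy : y ∈ D.Y)
    (hs : ∑ z ∈ D.Z y, D.wX (sphMul (D.base y) z) = D.wY y) : ∑ z ∈ D.Z y, D.wZ y z = 1 := by
  rw [Finset.sum_congr rfl (h.2 y hy), ← Finset.mul_sum] at hs
  exact mul_left_cancel₀ (D.wY_pos y hy).ne' (hs.trans (mul_one _).symm)

variable [MeasurableSpace S] {ρ : Measure S} {P : Set (S → ℝ)} {t : ℕ}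

/-- A design upstairs projects to a design downstairs. -/
theorem isWeightedDesign_of_X (hfib : ∀ y ∈ D.Y, ∀ z, proj (sphMul (D.base y) z) = y)
    (hpull : ∀ f ∈ P, f ∘ proj ∈ spherePoly (𝔽.Vec n) t ∧
      ⨍ y, f y ∂ρ = ∫ ω, f (proj ω) ∂sphereProb (𝔽.Vec n))
    (hsum : ∀ y ∈ D.Y, ∑ z ∈ D.Z y, D.wZ y z = 1) (hX : IsSphericalDesign t D.X D.wX) :
    IsWeightedDesign ρ P D.Y D.wY := by
  refine ⟨D.wY_pos, fun f hf => ?_⟩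
  have h := hX.2 _ (hpull f hf).1
  rw [sum_X (D.wellDefined hfib), average_toSphere] at h
  rw [(hpull f hf).2]
  refine Eq.trans (Finset.sum_congr rfl fun y hy => ?_) h
  have h1 : ∀ z ∈ D.Z y, D.wY y * D.wZ y z * (f ∘ proj) (sphMul (D.base y) z) =
      D.wY y * f y * D.wZ y z := fun z _ => by
    rw [Function.comp_apply, hfib y hy z]
    ring
  rw [Finset.sum_congr rfl h1, ← Finset.mul_sum, hsum y hy, mul_one]

/-- Designs on the fibres over a design downstairs form a design upstairs. -/
theorem isSphericalDesign_X (hfib : ∀ y ∈ D.Y, ∀ z, proj (sphMul (D.base y) z) = y)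
    (hpull : ∀ f ∈ P, ⨍ y, f y ∂ρ = ∫ ω, f (proj ω) ∂sphereProb (𝔽.Vec n))
    (hpush : ∀ s, 2 * s ≤ t → ∀ v : 𝔽.Vec n, ∃ G ∈ P,
      (∀ ω, (∀ z, proj (sphMul ω z) = proj ω) → G (proj ω) = ‖fibreAdj v ω.1‖ ^ (2 * s)) ∧
      ∫ ω, inner ℝ v ω.1 ^ (2 * s) ∂sphereProb (𝔽.Vec n) =
        sphereMoment 𝔽.Carrier (2 * s) * ∫ ω, G (proj ω) ∂sphereProb (𝔽.Vec n))
    (hZ : ∀ y ∈ D.Y, IsSphericalDesign t (D.Z y) (D.wZ y))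
    (hY : IsWeightedDesign ρ P D.Y D.wY) : IsSphericalDesign t D.X D.wX := by
  have hwd := D.wellDefined hfib
  refine isSphericalDesign_of_pow (wX_pos hwd) fun j hj v => ?_
  rw [sum_X hwd fun x => inner ℝ v x.1 ^ j]
  -- The design `Z_y` replaces the sum over the fibre by the exact average over `S^k`.
  have h1 : ∀ y ∈ D.Y, ∑ z ∈ D.Z y, D.wY y * D.wZ y z * inner ℝ v (sphMul (D.base y) z).1 ^ j =
      D.wY y * (sphereMoment 𝔽.Carrier j * ‖fibreAdj v (D.base y).1‖ ^ j) := by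
    intro y hy
    have h2 := (hZ y hy).2 _ (innerPow_mem_spherePoly hj (fibreAdj v (D.base y).1))
    rw [average_toSphere, integral_inner_pow] at h2
    rw [← h2, Finset.mul_sum]
    refine Finset.sum_congr rfl fun z _ => ?_
    rw [← inner_rmul, ← mul_assoc]
    rfl
  rw [Finset.sum_congr rfl h1]
  rcases Nat.even_or_odd' j with ⟨s, rfl | rfl⟩
  -- Pointwise, `G` is compared with `|A_v|^{2s}` only at the base points, whose orbits lie in
  -- fibres; the averages are matched separately by `hGint`. This separation is what admits `𝕆`.
  · obtain ⟨G, hG, hGfib, hGint⟩ := hpush s hj v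
    rw [hGint, ← hpull G hG, ← hY.2 G hG, Finset.mul_sum]
    refine Finset.sum_congr rfl fun y hy => ?_
    have h3 := hGfib (D.base y) fun z => by rw [hfib y hy z, D.proj_base y hy]
    rw [D.proj_base y hy] at h3
    rw [h3]
    ring
  · rw [integral_inner_pow]
    simp [sphereMoment_odd (odd_two_mul_add_one s)]

/-- The construction for any projection along whose fibres polynomials can be averaged. -/
theorem wellDefined_and_design_iff (hfib : ∀ y ∈ D.Y, ∀ z, proj (sphMul (D.base y) z) = y)
    (hpull : ∀ f ∈ P, f ∘ proj ∈ spherePoly (𝔽.Vec n) t ∧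
      ⨍ y, f y ∂ρ = ∫ ω, f (proj ω) ∂sphereProb (𝔽.Vec n))
    (hpush : ∀ s, 2 * s ≤ t → ∀ v : 𝔽.Vec n, ∃ G ∈ P,
      (∀ ω, (∀ z, proj (sphMul ω z) = proj ω) → G (proj ω) = ‖fibreAdj v ω.1‖ ^ (2 * s)) ∧
      ∫ ω, inner ℝ v ω.1 ^ (2 * s) ∂sphereProb (𝔽.Vec n) =
        sphereMoment 𝔽.Carrier (2 * s) * ∫ ω, G (proj ω) ∂sphereProb (𝔽.Vec n)) :
    D.WellDefined ∧
      ((∀ y ∈ D.Y, IsSphericalDesign t (D.Z y) (D.wZ y)) →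
        (IsSphericalDesign t D.X D.wX ↔ IsWeightedDesign ρ P D.Y D.wY)) ∧
      ((∀ y ∈ D.Y, ∑ z ∈ D.Z y, D.wX (sphMul (D.base y) z) = D.wY y) →
        IsSphericalDesign t D.X D.wX → IsWeightedDesign ρ P D.Y D.wY) := by
  have hwd := D.wellDefined hfib
  refine ⟨hwd, fun hZ => ⟨?_, ?_⟩, fun hs => ?_⟩
  · exact isWeightedDesign_of_X hfib hpull fun y hy => sum_wZ_of_design (hZ y hy)
  · exact isSphericalDesign_X hfib (fun f hf => (hpull f hf).2) hpush hZ
  · exact isWeightedDesign_of_X hfib hpull fun y hy => sum_wZ_of_sum_wX hwd hy (hs y hy)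

end

end FibreData

/-! ### Pulling back and pushing forward polynomials -/

theorem continuous_projMap : Continuous (projMap 𝔽 n) := continuous_coinduced_rng

theorem average_projMeasure {f : 𝔽.Proj n → ℝ} (hf : Continuous (f ∘ projMap 𝔽 n)) :
    ⨍ y, f y ∂projMeasure 𝔽 n = ∫ ω, f (projMap 𝔽 n ω) ∂sphereProb (𝔽.Vec n) := by
  have hmeas : Measurable (projMap 𝔽 n) := continuous_projMap.measurable
  have hf' : Continuous f := continuous_coinduced_dom.2 hf
  rw [← average_toSphere, average_eq, average_eq, projMeasure,
    integral_map hmeas.aemeasurable hf'.measurable.aestronglyMeasurable]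
  simp only [measureReal_def]
  rw [Measure.map_apply hmeas .univ, Set.preimage_univ]

/-- For even `t`, the degree `2⌊t/2⌋ + 1` allowed by `projPoly` is `t + 1`; evenness of the pullback
removes the excess. -/
theorem comp_projMap_mem_spherePoly {t : ℕ} {f : 𝔽.Proj n → ℝ} (hf : f ∈ projPoly 𝔽 n (t / 2)) :
    f ∘ projMap 𝔽 n ∈ spherePoly (𝔽.Vec n) t :=
  spherePoly_mono (Nat.mul_div_le t 2)
    (mem_spherePoly_of_even hf fun ω => congrArg f (projMap_neg ω))

theorem exists_comp_projMap_eq {g : 𝔽.Sph n → ℝ} (hg : ∀ ω, ∀ η ∈ projClass ω, g η = g ω) :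
    ∃ G : 𝔽.Proj n → ℝ, ∀ ω, G (projMap 𝔽 n ω) = g ω :=
  ⟨fun y => g y.2.choose, fun ω =>
    eq_of_projMap_eq hg (Subtype.ext (projMap 𝔽 n ω).2.choose_spec)⟩

theorem exists_projPoly_eq {s t : ℕ} (hs : 2 * s ≤ t) {g : 𝔽.Sph n → ℝ}
    (hg : ∀ ω, ∀ η ∈ projClass ω, g η = g ω) (hp : g ∈ spherePoly (𝔽.Vec n) 2) :
    ∃ G ∈ projPoly 𝔽 n (t / 2), ∀ ω, G (projMap 𝔽 n ω) = g ω ^ s := by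
  obtain ⟨G, hG⟩ := exists_comp_projMap_eq (g := fun ω => g ω ^ s) fun ω η hη => by
    rw [hg ω η hη]
  refine ⟨G, ?_, hG⟩
  have h : G ∘ projMap 𝔽 n = g ^ s := funext hG
  rw [projPoly, Set.mem_ofPred_eq, h]
  exact spherePoly_mono (by omega) (pow_mem_spherePoly hp s)

theorem projMap_eq_imp_hopfMap_eq {ω η : 𝔽.Sph 1} (h : projMap 𝔽 1 ω = projMap 𝔽 1 η) :
    hopfMap 𝔽 ω = hopfMap 𝔽 η :=
  eq_of_projMap_eq hopfMap_of_mem_projClass h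

theorem exists_push_projMap {s t : ℕ} (h : 𝔽 ≠ octonion) (hs : 2 * s ≤ t) (v : 𝔽.Vec n) :
    ∃ G ∈ projPoly 𝔽 n (t / 2),
      (∀ ω, (∀ z, projMap 𝔽 n (sphMul ω z) = projMap 𝔽 n ω) →
        G (projMap 𝔽 n ω) = ‖fibreAdj v ω.1‖ ^ (2 * s)) ∧
      ∫ ω, inner ℝ v ω.1 ^ (2 * s) ∂sphereProb (𝔽.Vec n) =
        sphereMoment 𝔽.Carrier (2 * s) *
          ∫ ω, G (projMap 𝔽 n ω) ∂sphereProb (𝔽.Vec n) := by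
  obtain ⟨G, hG, hGeq⟩ := exists_projPoly_eq hs
    (fun ω η hη => by rw [norm_fibreAdj_of_mem_projClass h v ω η hη])
    (norm_fibreAdj_sq_mem_spherePoly v)
  refine ⟨G, hG, fun ω _ => by rw [hGeq, pow_mul], ?_⟩
  simp only [hGeq, ← pow_mul]
  exact integral_inner_pow_eq_fibre _ v

theorem hopfForm_mem_spherePoly (v : 𝔽.Vec 1) :
    (fun ω : 𝔽.Sph 1 => hopfForm v ω.1) ∈ spherePoly (𝔽.Vec 1) 2 := by
  have h := smul_mem_spherePoly (2⁻¹ : ℝ) (add_mem_spherePoly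
    (const_mem_spherePoly (‖v‖ ^ 2) 2) (inner_hopfFun_mem_spherePoly (hopfFun v)))
  convert h using 1
  funext ω
  simp [hopfForm]

/-- `hopfForm` sees `ω` on the sphere only through its Hopf image, which is constant on projective
classes, so it descends to `𝔽P¹` without associativity. -/
theorem exists_push_projMap_one {s t : ℕ} (hs : 2 * s ≤ t) (v : 𝔽.Vec 1) :
    ∃ G ∈ projPoly 𝔽 1 (t / 2),
      (∀ ω, (∀ z, projMap 𝔽 1 (sphMul ω z) = projMap 𝔽 1 ω) →
        G (projMap 𝔽 1 ω) = ‖fibreAdj v ω.1‖ ^ (2 * s)) ∧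
      ∫ ω, inner ℝ v ω.1 ^ (2 * s) ∂sphereProb (𝔽.Vec 1) =
        sphereMoment 𝔽.Carrier (2 * s) *
          ∫ ω, G (projMap 𝔽 1 ω) ∂sphereProb (𝔽.Vec 1) := by
  obtain ⟨G, hG, hGeq⟩ := exists_projPoly_eq hs (fun ω η hη => by
    have h : hopfFun η.1 = hopfFun ω.1 := congrArg Subtype.val (hopfMap_of_mem_projClass ω η hη)
    rw [hopfForm, hopfForm, h, norm_eq_of_mem_sphere, norm_eq_of_mem_sphere])
    (hopfForm_mem_spherePoly v)
  refine ⟨G, hG, fun ω hω => ?_, ?_⟩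
  · rw [hGeq, pow_mul,
      norm_fibreAdj_sq_eq_hopfForm fun z => projMap_eq_imp_hopfMap_eq (hω z)]
  · simp only [hGeq]
    exact integral_inner_pow_eq_hopfForm s v

/-- On the unit sphere `hopfForm v` is an affine function of `π ω`, so its `s`-th power has degree
`s ≤ ⌊t/2⌋` on `S^{k+1}`. -/
theorem exists_push_hopfMap {s t : ℕ} (hs : 2 * s ≤ t) (v : 𝔽.Vec 1) :
    ∃ G ∈ spherePoly 𝔽.HopfVec (t / 2),
      (∀ ω, (∀ z, hopfMap 𝔽 (sphMul ω z) = hopfMap 𝔽 ω) →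
        G (hopfMap 𝔽 ω) = ‖fibreAdj v ω.1‖ ^ (2 * s)) ∧
      ∫ ω, inner ℝ v ω.1 ^ (2 * s) ∂sphereProb (𝔽.Vec 1) =
        sphereMoment 𝔽.Carrier (2 * s) *
          ∫ ω, G (hopfMap 𝔽 ω) ∂sphereProb (𝔽.Vec 1) := by
  let g : 𝔽.HopfSph → ℝ := fun y => 2⁻¹ * (‖v‖ ^ 2 + inner ℝ (hopfFun v) y.1)
  have hg : g ∈ spherePoly 𝔽.HopfVec 1 := smul_mem_spherePoly (2⁻¹ : ℝ) (add_mem_spherePoly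
    (const_mem_spherePoly (‖v‖ ^ 2) 1) (dual_mem_spherePoly (innerₗ 𝔽.HopfVec (hopfFun v))))
  have hgeq : ∀ ω, g (hopfMap 𝔽 ω) = hopfForm v ω.1 := fun ω => by
    rw [hopfForm, norm_eq_of_mem_sphere, one_pow, mul_one]
    rfl
  refine ⟨g ^ s, spherePoly_mono (by omega) (pow_mem_spherePoly hg s), fun ω hω => ?_, ?_⟩
  · rw [Pi.pow_apply, hgeq, pow_mul, norm_fibreAdj_sq_eq_hopfForm hω]
  · simp only [Pi.pow_apply, hgeq]
    exact integral_inner_pow_eq_hopfForm s v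

end DivAlg

end

theorem theorem1p1 (𝔽 : DivAlg) (t : ℕ) :
    -- the projective maps `S^d → 𝔽Pⁿ`
    (∀ n : ℕ, 1 ≤ n → (𝔽 = DivAlg.octonion → n = 1) →
      ∀ D : DivAlg.FibreData (DivAlg.projMap 𝔽 n),
        D.WellDefined ∧
        ((∀ y ∈ D.Y, IsSphericalDesign t (D.Z y) (D.wZ y)) →
          (IsSphericalDesign t D.X D.wX ↔ DivAlg.IsProjDesign (t / 2) D.Y D.wY)) ∧
        ((∀ y ∈ D.Y, ∑ z ∈ D.Z y, D.wX (DivAlg.sphMul (D.base y) z) = D.wY y) →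
          IsSphericalDesign t D.X D.wX → DivAlg.IsProjDesign (t / 2) D.Y D.wY)) ∧
    -- the Hopf maps `S^{2k+1} → S^{k+1}`
    (∀ D : DivAlg.FibreData (DivAlg.hopfMap 𝔽),
        D.WellDefined ∧
        ((∀ y ∈ D.Y, IsSphericalDesign t (D.Z y) (D.wZ y)) →
          (IsSphericalDesign t D.X D.wX ↔ IsSphericalDesign (t / 2) D.Y D.wY)) ∧
        ((∀ y ∈ D.Y, ∑ z ∈ D.Z y, D.wX (DivAlg.sphMul (D.base y) z) = D.wY y) →
          IsSphericalDesign t D.X D.wX → IsSphericalDesign (t / 2) D.Y D.wY)) := by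
  constructor
  · intro n _ hn D
    refine DivAlg.FibreData.wellDefined_and_design_iff ?_ (fun f hf => ?_) fun s hs v => ?_
    · intro y hy z
      by_cases h : 𝔽 = DivAlg.octonion
      · exact D.octonion_fibre h y hy z
      · rw [DivAlg.projMap_sphMul h, D.proj_base y hy]
    · have h := DivAlg.comp_projMap_mem_spherePoly hf
      exact ⟨h, DivAlg.average_projMeasure (continuous_of_mem_spherePoly h)⟩
    -- Over `𝕆` the norm of `fibreAdj` need not be constant on classes; `n = 1` makes `hopfForm`
    -- available instead.
    · by_cases h : 𝔽 = DivAlg.octonion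
      · obtain rfl := hn h
        exact DivAlg.exists_push_projMap_one hs v
      · exact DivAlg.exists_push_projMap h hs v
  · intro D
    refine DivAlg.FibreData.wellDefined_and_design_iff ?_ (fun f hf => ⟨?_, ?_⟩) fun s hs v =>
      DivAlg.exists_push_hopfMap hs v
    · intro y hy z
      by_cases h : 𝔽 = DivAlg.octonion
      · exact D.octonion_fibre h y hy z
      · rw [DivAlg.hopfMap_sphMul h, D.proj_base y hy]
    · exact spherePoly_mono (Nat.mul_div_le t 2) (DivAlg.comp_hopfMap_mem_spherePoly hf)
    · rw [average_toSphere, DivAlg.integral_comp_hopfMap hf]
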